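/- **Theorem C.** Let $X$ be a (connected) complex projective manifold, with field of rational functions $\mathbb C(X)$, and let $\mathcal G$ be a singular holomorphic foliation of codimension $q\ge 2$ on $X$. (A foliation $\mathcal F$ is a pair of subsheaves $T_{\mathcal F}\subset T_X$, $N^*_{\mathcal F}\subset\Omega^1_X$, each the annihilator of the other, with $T_{\mathcal F}$ closed under Lie brackets; its codimension is the generic rank of $N^*_{\mathcal F}$; $\mathcal F$ contains $\mathcal G$ if $T_{\mathcal G}\subset T_{\mathcal F}$; the intersection of foliations is the foliation whose tangent sheaf is the intersection of their tangent sheaves.) Let $\mathbb C(X/\mathcal G)\subset\mathbb C(X)$ be the field of rational first integrals of $\mathcal G$, that is, of the rational functions annihilated by every local section of $T_{\mathcal G}$. Assume that $\operatorname{trdeg}_{\mathbb C}\mathbb C(X/\mathcal G)=0$ and that $\mathcal G$ is contained in $q+1$ codimension one foliations $\mathcal F_1,\dots,\mathcal F_{q+1}$ such that the intersection of any $q$ of them is equal to $\mathcal G$. Then at least one of the following holds. 1. There are rational $1$-forms $\omega_1,\dots,\omega_q$ on $X$ defining $\mathcal G$ (i.e. $T_{\mathcal G}$ is their common kernel in $T_X$)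 such that, for every $0\le r<q$, sending an $r$-plane $V\subset\mathbb C^q$ to the foliation with tangent sheaf $\{v\in T_X : \sum_i a_i\omega_i(v)=0 \text{ for all } a\in V\}$ is a well-defined bijection from the Grassmannian of $r$-planes in $\mathbb C^q$ onto the set of codimension $r$ foliations containing $\mathcal G$. Moreover, every foliation containing $\mathcal G$ is an intersection of finitely many transversely affine codimension one foliations (the empty intersection being the foliation with tangent sheaf $T_X$). Here a codimension one foliation is transversely affine if it is defined by a rational $1$-form $\alpha_0$ for which there is a closed rational $1$-form $\alpha_1$ with $d\alpha_0=\alpha_0\wedge\alpha_1$. 2. There are a non-abelian complex Lie algebra $\mathfrak g$ of dimension $q$ and a rational $1$-form $\Omega$ on $X$ with values in $\mathfrak g$ such that $d\Omega+\frac12[\Omega,\Omega]=0$ and $T_{\mathcal G}$ is the kernel of $\Omega$ in $T_X$ (that is, $\mathcal G$ is transversely Lie modeled over $\mathfrak g$). For every $0\le r<q$, sending a Lie subalgebra $\mathfrak h\subset\mathfrak g$ to the foliation whose tangent sheaf is the kernel of the composition of $\Omega$ with the projection $\mathfrak g\to\mathfrak g/\mathfrak h$ is a well-defined bijection from the set of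 Lie subalgebras of $\mathfrak g$ of codimension $r$ onto the set of codimension $r$ foliations containing $\mathcal G$. Moreover, every foliation $\mathcal F$ containing $\mathcal G$ is transversely homogeneous: there are a finite-dimensional complex Lie algebra $\mathfrak g'$, a rational $1$-form $\Omega'$ with values in $\mathfrak g'$ satisfying $d\Omega'+\frac12[\Omega',\Omega']=0$, and a Lie subalgebra $\mathfrak h'\subset\mathfrak g'$ with $\dim\mathfrak g'-\dim\mathfrak h'=\operatorname{codim}\mathcal F$ such that $T_{\mathcal F}$ is the kernel of the composition of $\Omega'$ with $\mathfrak g'\to\mathfrak g'/\mathfrak h'$. -/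

import Mathlib

open AlgebraicGeometry CategoryTheory TopologicalSpace
open scoped TensorProduct

noncomputable section

/-- The grading of `ℂ[x₀, …, x_N]` by degree. -/
abbrev polyGrading (N : ℕ) : ℕ → Submodule ℂ (MvPolynomial (Fin (N + 1)) ℂ) :=
  MvPolynomial.homogeneousSubmodule (Fin (N + 1)) ℂ

instance (N : ℕ) : GradedAlgebra (polyGrading N) := MvPolynomial.gradedAlgebra

/-- The complex projective space `ℙ^N`. -/
def complexProjectiveSpace (N : ℕ) : Scheme.{0} := Proj (polyGrading N)

/-- The structure morphism `ℙ^N ⟶ Spec ℂ`. -/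
def complexProjectiveSpace.structureMap (N : ℕ) :
    complexProjectiveSpace N ⟶ Spec (CommRingCat.of ℂ) :=
  Proj.toSpecZero (polyGrading N) ≫
    Spec.map (CommRingCat.ofHom (algebraMap ℂ (polyGrading N 0)))

/-- A (connected) complex projective manifold, that is an integral smooth scheme over `ℂ`
which is isomorphic to a closed subscheme of some `ℙ^N`. -/
structure ProjectiveManifold where
  scheme : Scheme.{0}
  structureMap : scheme ⟶ Spec (CommRingCat.of ℂ)
  isIntegral : IsIntegral scheme
  smooth : Smooth structureMap
  projective : ∃ (N : ℕ) (i : scheme ⟶ complexProjectiveSpace N),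
    IsClosedImmersion i ∧ i ≫ complexProjectiveSpace.structureMap N = structureMap

namespace ProjectiveManifold

attribute [instance] ProjectiveManifold.isIntegral

/-- The field `ℂ(X)` of rational functions of `X`. -/
def RationalFunction (X : ProjectiveManifold) : Type := X.scheme.functionField

instance (X : ProjectiveManifold) : Field X.RationalFunction :=
  inferInstanceAs (Field X.scheme.functionField)

/-- The inclusion of the constants in `ℂ(X)`: pull back a constant from `Spec ℂ` to a global
section of the structure sheaf of `X` and take the germ at the generic point. -/
def constants (X : ProjectiveManifold) : ℂ →+* X.RationalFunction :=
  (X.scheme.presheaf.germ ⊤ (genericPoint X.scheme) trivial).hom.comp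
    ((X.structureMap.appTop).hom.comp (Scheme.ΓSpecIso (CommRingCat.of ℂ)).inv.hom)

instance (X : ProjectiveManifold) : Algebra ℂ X.RationalFunction :=
  X.constants.toAlgebra

/-- The rational vector fields on `X`: the derivations of `ℂ(X)` over `ℂ`. -/
abbrev RationalVectorField (X : ProjectiveManifold) : Type :=
  Derivation ℂ X.RationalFunction X.RationalFunction

/-- The rational `1`-forms on `X`: the Kähler differentials of `ℂ(X)` over `ℂ`. -/
abbrev RationalForm (X : ProjectiveManifold) : Type :=
  Ω[X.RationalFunction⁄ℂ]

/-- The contraction `ω(v)` of a rational `1`-form with a rational vector field. -/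
def contract (X : ProjectiveManifold) (ω : X.RationalForm) (v : X.RationalVectorField) :
    X.RationalFunction :=
  v.liftKaehlerDifferential ω

/-- The value `dω(v, w)` of the exterior derivative of a rational `1`-form. -/
def extDeriv (X : ProjectiveManifold) (ω : X.RationalForm) (v w : X.RationalVectorField) :
    X.RationalFunction :=
  v (X.contract ω w) - w (X.contract ω v) - X.contract ω ⁅v, w⁆

/-- The local ring of `X` at a point `x`, as a subring of `ℂ(X)`. -/
def localRing (X : ProjectiveManifold) (x : X.scheme) : Subring X.RationalFunction :=
  (algebraMap (X.scheme.presheaf.stalk x) X.scheme.functionField).range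

/-- The non-empty Zariski open subsets of `X`. -/
abbrev NonemptyOpen (X : ProjectiveManifold) : Type :=
  {U : Opens X.scheme // (U : Set X.scheme).Nonempty}

/-- The ring `𝒪_X(U)`, as a subring of `ℂ(X)`. -/
def functions (X : ProjectiveManifold) (U : X.NonemptyOpen) : Subring X.RationalFunction :=
  ⨅ x ∈ U.1, X.localRing x

/-- The sections `T_X(U)` of the tangent sheaf, as a set of rational vector fields: those which
preserve the local ring of every point of `U`. -/
def vectorFields (X : ProjectiveManifold) (U : X.NonemptyOpen) : Set X.RationalVectorField :=
  {v | ∀ x ∈ U.1, ∀ f ∈ X.localRing x, v f ∈ X.localRing x}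

/-- The sections `Ω¹_X(U)` of the cotangent sheaf, as a set of rational `1`-forms: those which
at every `x ∈ U` are combinations `∑ fᵢ dgᵢ` with `fᵢ`, `gᵢ` in the local ring of `x`. -/
def forms (X : ProjectiveManifold) (U : X.NonemptyOpen) : Set X.RationalForm :=
  {ω | ∀ x ∈ U.1, ω ∈ Submodule.span (X.localRing x)
    (KaehlerDifferential.D ℂ X.RationalFunction '' (X.localRing x : Set X.RationalFunction))}

end ProjectiveManifold

/-- A singular holomorphic foliation on the projective manifold `X`: a pair `(T_F, N*_F)` of
subsheaves of `𝒪_X`-modules of `(T_X, Ω¹_X)`, each the annihilator of the other, with `T_F`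
involutive. Sections over a non-empty open set are seen as rational vector fields and rational
`1`-forms, so that the restriction maps are inclusions; compatibility with restriction and the
gluing property follow from the two annihilator conditions. -/
@[ext]
structure Foliation (X : ProjectiveManifold) where
  tangent : ∀ U : X.NonemptyOpen, Submodule (X.functions U) X.RationalVectorField
  conormal : ∀ U : X.NonemptyOpen, Submodule (X.functions U) X.RationalForm
  mem_tangent_iff : ∀ (U : X.NonemptyOpen) (v : X.RationalVectorField),
    v ∈ tangent U ↔ v ∈ X.vectorFields U ∧
      ∀ V : X.NonemptyOpen, V ≤ U → ∀ ω ∈ conormal V, X.contract ω v = 0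
  mem_conormal_iff : ∀ (U : X.NonemptyOpen) (ω : X.RationalForm),
    ω ∈ conormal U ↔ ω ∈ X.forms U ∧
      ∀ V : X.NonemptyOpen, V ≤ U → ∀ v ∈ tangent V, X.contract ω v = 0
  involutive : ∀ (U : X.NonemptyOpen), ∀ v ∈ tangent U, ∀ w ∈ tangent U, ⁅v, w⁆ ∈ tangent U

namespace Foliation

variable {X : ProjectiveManifold}

/-- The space of rational sections of the conormal sheaf of `F`. -/
def rationalConormal (F : Foliation X) : Submodule X.RationalFunction X.RationalForm :=
  Submodule.span X.RationalFunction (⋃ U, (F.conormal U : Set X.RationalForm))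

/-- The codimension of `F`: the generic rank of the conormal sheaf. -/
def codim (F : Foliation X) : ℕ :=
  Module.finrank X.RationalFunction F.rationalConormal

/-- The tangent sheaf of `F` consists of the vector fields which belong to `W`. -/
def DefinedBy (F : Foliation X) (W : Set X.RationalVectorField) : Prop :=
  ∀ (U : X.NonemptyOpen) (v : X.RationalVectorField),
    v ∈ F.tangent U ↔ v ∈ X.vectorFields U ∧ v ∈ W

/-- `G.ContainedIn F`: the tangent sheaf of `F` contains the tangent sheaf of `G`. -/
def ContainedIn (G F : Foliation X) : Prop :=
  ∀ (U : X.NonemptyOpen), ∀ v ∈ G.tangent U, v ∈ F.tangent U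

/-- `F` is the intersection of the foliations in `S`. -/
def IsIntersection (F : Foliation X) (S : Set (Foliation X)) : Prop :=
  ∀ (U : X.NonemptyOpen) (v : X.RationalVectorField),
    v ∈ F.tangent U ↔ v ∈ X.vectorFields U ∧ ∀ H ∈ S, v ∈ H.tangent U

/-- The field `ℂ(X/F)` of rational first integrals of `F`. -/
def firstIntegrals (F : Foliation X) : IntermediateField ℂ X.RationalFunction where
  carrier := {f | ∀ (U : X.NonemptyOpen), ∀ v ∈ F.tangent U, v f = 0}
  mul_mem' := by
    intro a b ha hb U v hv
    simp [ha U v hv, hb U v hv]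
  add_mem' := by
    intro a b ha hb U v hv
    simp [ha U v hv, hb U v hv]
  algebraMap_mem' := by
    intro c U v _
    simp
  inv_mem' := by
    intro a ha U v hv
    simp [Derivation.leibniz_inv, ha U v hv]

/-- A codimension one foliation is (singularly) transversely affine if it is defined by a rational
`1`-form `ω₀` for which there is a closed rational `1`-form `ω₁` with `dω₀ = ω₀ ∧ ω₁`. -/
def IsTransverselyAffine (F : Foliation X) : Prop :=
  F.codim = 1 ∧ ∃ ω₀ ω₁ : X.RationalForm,
    F.DefinedBy {v | X.contract ω₀ v = 0} ∧
    (∀ v w, X.extDeriv ω₁ v w = 0) ∧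
    ∀ v w, X.extDeriv ω₀ v w =
      X.contract ω₀ v * X.contract ω₁ w - X.contract ω₀ w * X.contract ω₁ v

end Foliation

section LieValuedForms

variable (X : ProjectiveManifold) (𝔤 : Type) [LieRing 𝔤] [LieAlgebra ℂ 𝔤]

/-- A rational `1`-form on `X` with values in `𝔤`, given by its contraction with rational vector
fields. -/
abbrev LieValuedForm : Type :=
  X.RationalVectorField →ₗ[X.RationalFunction] (X.RationalFunction ⊗[ℂ] 𝔤)

variable {X 𝔤}

/-- The derivative of a rational function with values in `𝔤` along a rational vector field. -/
def lieDerivative (v : X.RationalVectorField) :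
    (X.RationalFunction ⊗[ℂ] 𝔤) →ₗ[ℂ] (X.RationalFunction ⊗[ℂ] 𝔤) :=
  LinearMap.rTensor 𝔤 (v : X.RationalFunction →ₗ[ℂ] X.RationalFunction)

/-- The Maurer-Cartan equation `dΩ + ½[Ω, Ω] = 0`, evaluated on pairs of rational vector fields. -/
def MaurerCartan (Ω : LieValuedForm X 𝔤) : Prop :=
  ∀ v w : X.RationalVectorField,
    (lieDerivative v (Ω w) - lieDerivative w (Ω v) - Ω ⁅v, w⁆) + ⁅Ω v, Ω w⁆ = 0

/-- The kernel of the composition of contraction with `Ω` and the projection to `ℂ(X) ⊗ 𝔤/𝔥`. -/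
def kernelMod (Ω : LieValuedForm X 𝔤) (𝔥 : LieSubalgebra ℂ 𝔤) : Set X.RationalVectorField :=
  {v | LinearMap.lTensor X.RationalFunction 𝔥.toSubmodule.mkQ (Ω v) = 0}

/-- `Ω` is a rational transverse `𝔤`-structure for `F`. -/
def IsTransverseLieStructure (F : Foliation X) (Ω : LieValuedForm X 𝔤) : Prop :=
  Module.Finite ℂ 𝔤 ∧ Module.finrank ℂ 𝔤 = F.codim ∧ F.DefinedBy {v | Ω v = 0} ∧ MaurerCartan Ω

/-- `(Ω, 𝔥)` is a (singularly) transversely homogeneous structure for `F`. -/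
def IsTransverseHomogeneousStructure (F : Foliation X) (Ω : LieValuedForm X 𝔤)
    (𝔥 : LieSubalgebra ℂ 𝔤) : Prop :=
  Module.Finite ℂ 𝔤 ∧ MaurerCartan Ω ∧ Module.finrank ℂ 𝔥 + F.codim = Module.finrank ℂ 𝔤 ∧
    F.DefinedBy (kernelMod Ω 𝔥)

end LieValuedForms

/-- `F` is (singularly) transversely homogeneous. -/
def Foliation.IsTransverselyHomogeneous {X : ProjectiveManifold} (F : Foliation X) : Prop :=
  ∃ (𝔤 : Type) (_ : LieRing 𝔤) (_ : LieAlgebra ℂ 𝔤) (Ω : LieValuedForm X 𝔤)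
    (𝔥 : LieSubalgebra ℂ 𝔤), IsTransverseHomogeneousStructure F Ω 𝔥

/-- The set of foliations of codimension `r` containing `G`. -/
abbrev FoliationsContaining {X : ProjectiveManifold} (G : Foliation X) (r : ℕ) : Type :=
  {F : Foliation X // G.ContainedIn F ∧ F.codim = r}

/-- The Grassmannian of `r`-planes in `ℂ^q`. -/
abbrev GrassmannianOfPlanes (q r : ℕ) : Type :=
  {V : Submodule ℂ (Fin q → ℂ) // Module.finrank ℂ V = r}

/-- The variety of Lie subalgebras of `𝔤` of codimension `r`. -/
abbrev SubalgebrasOfCodim (𝔤 : Type) [LieRing 𝔤] [LieAlgebra ℂ 𝔤] (r : ℕ) : Type :=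
  {𝔥 : LieSubalgebra ℂ 𝔤 // Module.finrank ℂ 𝔥 + r = Module.finrank ℂ 𝔤}

/-- The foliations containing `G` are naturally identified with the linear subspaces of `ℂ^q`:
for suitable rational `1`-forms `ω₁, …, ω_q` defining `G`, the foliation corresponding to an
`r`-plane `V` is the one defined by the `1`-forms `∑ aᵢ ωᵢ` with `a ∈ V`. -/
def IdentifiedWithGrassmannians {X : ProjectiveManifold} (G : Foliation X) (q : ℕ) : Prop :=
  ∃ ω : Fin q → X.RationalForm,
    G.DefinedBy {v | ∀ i, X.contract (ω i) v = 0} ∧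
    ∀ r < q, ∃ e : GrassmannianOfPlanes q r ≃ FoliationsContaining G r,
      ∀ V, (e V).1.DefinedBy {v | ∀ a ∈ V.1, ∑ i, a i • X.contract (ω i) v = 0}

/-- The foliations containing `G` are naturally identified, through the transverse `𝔤`-structure
`Ω`, with the Lie subalgebras of `𝔤`: the foliation corresponding to `𝔥` is the kernel
of `Ω` modulo `𝔥`. -/
def IdentifiedWithSubalgebras {X : ProjectiveManifold} (G : Foliation X) (q : ℕ)
    {𝔤 : Type} [LieRing 𝔤] [LieAlgebra ℂ 𝔤] (Ω : LieValuedForm X 𝔤) : Prop :=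
  ∀ r < q, ∃ e : SubalgebrasOfCodim 𝔤 r ≃ FoliationsContaining G r,
    ∀ 𝔥, (e 𝔥).1.DefinedBy (kernelMod Ω 𝔥.1)

end

/-!
Scale defining forms `ω₁, …, ω_q` of all but one of the foliations so that their sum defines the
remaining one, and let `v₁, …, v_q` be a dual frame. Since each `ker ωᵢ` and `ker (∑ ωᵢ)` is
involutive, every `t ∈ T_G` acts on all the `vᵢ` modulo `T_G` by one and the same scalar `c(t)`.

If no non-zero rational function `f` satisfies `t f = c(t) f` for all `t ∈ T_G`, the forms `ηᵢ` with
`dωᵢ = ηᵢ ∧ ωᵢ` can be chosen equal to a single form `η`, which moreover is closed. As first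
integrals are constant, the relations satisfied by the `ωᵢ` on a foliation containing `G` are
generated by relations with constant coefficients, so the foliation comes from a subspace of `ℂ^q`.

Otherwise the fields `f⁻¹ vᵢ` are infinitesimal symmetries of `G`. Infinitesimal symmetries modulo
`T_G` then form a Lie algebra of dimension `q`, the normal space of `G` being its extension of
scalars, and the resulting tautological form satisfies the Maurer-Cartan equation. By the same
descent, foliations containing `G` come from subalgebras. When this Lie algebra is abelian the
forms `f ωᵢ` are closed, so that `η = 0` works.
-/

noncomputable section

section OneForms

variable {k K : Type*} [CommRing k] [CommRing K] [Algebra k K]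

theorem smul_lie_derivation (v w : Derivation k K K) (f : K) :
    ⁅f • v, w⁆ = f • ⁅v, w⁆ - w f • v := by
  rw [← lie_skew, LieRinehartRing.leibniz_smul_right, Derivation.bracket_eq_fun, ← lie_skew v w,
    smul_neg]
  abel

variable (k K) in
/-- The `1`-forms dual to the derivations of `K` over `k`, that is the linear functionals on
them. When `K / k` is a finitely generated field extension these are the Kähler differentials. -/
abbrev OneForm : Type _ := Module.Dual K (Derivation k K K)

namespace OneForm

/-- The exterior derivative `dω`, given by Koszul's formula as a bilinear form on derivations. -/
def extD : OneForm k K →ₗ[k] Derivation k K K →ₗ[K] Derivation k K K →ₗ[K] K where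
  toFun ω := LinearMap.mk₂ K (fun v w => v (ω w) - w (ω v) - ω ⁅v, w⁆)
    (by intros; simp; ring)
    (by intros; simp [smul_lie_derivation]; ring)
    (by intros; simp; ring)
    (by intros; simp; ring)
  map_add' ω η := by ext v w; simp; ring
  map_smul' a ω := by ext v w; simp [smul_sub]

theorem extD_apply (ω : OneForm k K) (v w : Derivation k K K) :
    extD ω v w = v (ω w) - w (ω v) - ω ⁅v, w⁆ := rfl

theorem extD_swap (ω : OneForm k K) (v w : Derivation k K K) : extD ω v w = -extD ω w v := by
  rw [extD_apply, extD_apply, ← lie_skew v w, map_neg]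
  ring

@[simp]
theorem extD_self (ω : OneForm k K) (v : Derivation k K K) : extD ω v v = 0 := by
  simp [extD_apply]

theorem extD_smul (f : K) (ω : OneForm k K) (v w : Derivation k K K) :
    extD (f • ω) v w = v f * ω w - w f * ω v + f * extD ω v w := by
  simp only [extD_apply, LinearMap.smul_apply, smul_eq_mul, Derivation.leibniz]
  ring

/-- The exact form `df`. -/
def differential (f : K) : OneForm k K where
  toFun v := v f
  map_add' _ _ := rfl
  map_smul' _ _ := rfl

@[simp]
theorem differential_apply (f : K) (v : Derivation k K K) : differential f v = v f := rfl

@[simp]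
theorem extD_differential (f : K) : extD (differential f : OneForm k K) = 0 := by
  ext v w
  simp [extD_apply, Derivation.commutator_apply]

theorem extD_extD (ω : OneForm k K) (a b c : Derivation k K K) :
    a (extD ω b c) + b (extD ω c a) + c (extD ω a b)
      - extD ω ⁅a, b⁆ c - extD ω ⁅b, c⁆ a - extD ω ⁅c, a⁆ b = 0 := by
  have jacobi : ω ⁅⁅a, b⁆, c⁆ + ω ⁅⁅b, c⁆, a⁆ + ω ⁅⁅c, a⁆, b⁆ = 0 := by
    have := congrArg ω (lie_jacobi a b c)
    rw [← lie_skew ⁅b, c⁆ a, ← lie_skew ⁅c, a⁆ b, ← lie_skew ⁅a, b⁆ c] at *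
    simp only [map_add, map_neg, map_zero] at this ⊢
    linear_combination -this
  simp only [extD_apply, map_sub, Derivation.commutator_apply]
  linear_combination jacobi

/-- The wedge product `η ∧ ω`, as a bilinear form on derivations. -/
def wedge (η ω : OneForm k K) : Derivation k K K →ₗ[K] Derivation k K K →ₗ[K] K :=
  η.smulRight ω - ω.smulRight η

@[simp]
theorem wedge_apply (η ω : OneForm k K) (v w : Derivation k K K) :
    wedge η ω v w = η v * ω w - ω v * η w := rfl

theorem wedge_add_smul_self (η ω : OneForm k K) (a : K) : wedge (η + a • ω) ω = wedge η ω := by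
  ext v w
  simp only [wedge_apply, LinearMap.add_apply, LinearMap.smul_apply, smul_eq_mul]
  ring

/-- This is `d(η ∧ ω) = 0` in the form `dη ∧ ω = 0`. -/
theorem extD_wedge {η ω : OneForm k K} (h : extD ω = wedge η ω) (a b c : Derivation k K K) :
    extD η a b * ω c + extD η b c * ω a + extD η c a * ω b = 0 := by
  have hω : ∀ v w, extD ω v w = η v * ω w - ω v * η w := fun v w => by rw [h, wedge_apply]
  have closed := extD_extD ω a b c
  simp only [hω, map_sub, Derivation.leibniz, smul_eq_mul] at closed
  have hab := hω a b
  have hbc := hω b c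
  have hca := hω c a
  simp only [extD_apply] at hab hbc hca ⊢
  linear_combination closed + η c * hab + η a * hbc + η b * hca

end OneForm

/-- A distribution of derivations is involutive if it is closed under Lie brackets. -/
def IsInvolutive (W : Submodule K (Derivation k K K)) : Prop :=
  ∀ a ∈ W, ∀ b ∈ W, ⁅a, b⁆ ∈ W

theorem IsInvolutive.iInf {ι : Sort*} {W : ι → Submodule K (Derivation k K K)}
    (hW : ∀ i, IsInvolutive (W i)) : IsInvolutive (⨅ i, W i) := by
  simp only [IsInvolutive, Submodule.mem_iInf]
  exact fun a ha b hb i => hW i a (ha i) b (hb i)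

open OneForm

theorem isInvolutive_ker_of_extD_eq_wedge {η ω : OneForm k K} (h : extD ω = wedge η ω) :
    IsInvolutive (LinearMap.ker ω) := by
  intro a ha b hb
  have := congr($h a b)
  simpa [extD_apply, LinearMap.mem_ker.1 ha, LinearMap.mem_ker.1 hb] using this

theorem exists_extD_eq_wedge {ω : OneForm k K} {v : Derivation k K K} (hv : ω v = 1)
    (h : IsInvolutive (LinearMap.ker ω)) : ∃ η : OneForm k K, extD ω = wedge η ω := by
  have extD_ker : ∀ a, ω a = 0 → ∀ b, ω b = 0 → extD ω a b = 0 := fun a ha b hb => by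
    have : ω ⁅a, b⁆ = 0 := h a ha b hb
    rw [extD_apply, ha, hb, this, map_zero, map_zero, sub_zero, sub_zero]
  refine ⟨(extD ω).flip v, ?_⟩
  ext a b
  have := extD_ker (a - ω a • v) (by simp [hv]) (b - ω b • v) (by simp [hv])
  simp only [map_sub, map_smul, LinearMap.sub_apply, LinearMap.smul_apply, smul_eq_mul, extD_self,
    extD_swap ω v b] at this
  rw [wedge_apply, LinearMap.flip_apply, LinearMap.flip_apply]
  linear_combination this

end OneForms

section LogarithmicDifferential

variable {k K : Type*} [CommRing k] [Field K] [Algebra k K]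

namespace OneForm

/-- The logarithmic differential `df / f`. -/
def dlog (f : K) : OneForm k K := f⁻¹ • differential f

@[simp]
theorem dlog_apply (f : K) (v : Derivation k K K) : dlog f v = f⁻¹ * v f := rfl

@[simp]
theorem extD_dlog (f : K) : extD (dlog f : OneForm k K) = 0 := by
  ext v w
  rw [dlog, extD_smul, extD_differential]
  simp only [Derivation.leibniz_inv, differential_apply, smul_eq_mul, LinearMap.zero_apply]
  ring

end OneForm

end LogarithmicDifferential

section TransverseFrames

/-- Linear functionals `ω` with common kernel `T` and a dual family of vectors `v`, which is thus a
basis of a complement of `T`. -/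
structure TransverseFrame {K E ι : Type*} [CommRing K] [AddCommGroup E] [Module K E]
    [DecidableEq ι] (T : Submodule K E) (ω : ι → Module.Dual K E) (v : ι → E) : Prop where
  iInf_ker : ⨅ i, LinearMap.ker (ω i) = T
  dual : ∀ i j, ω i (v j) = if i = j then 1 else 0

namespace TransverseFrame

section CommRing

variable {K E ι : Type*} [CommRing K] [AddCommGroup E] [Module K E] [DecidableEq ι]
  {T : Submodule K E} {ω : ι → Module.Dual K E} {v : ι → E}

theorem mem_iff (h : TransverseFrame T ω v) {x : E} : x ∈ T ↔ ∀ i, ω i x = 0 := by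
  simp [← h.iInf_ker]

theorem apply_self (h : TransverseFrame T ω v) (i : ι) : ω i (v i) = 1 := by simp [h.dual]

theorem apply_ne (h : TransverseFrame T ω v) {i j : ι} (hij : i ≠ j) : ω i (v j) = 0 := by
  simp [h.dual, hij]

theorem sub_sum_mem [Fintype ι] (h : TransverseFrame T ω v) (x : E) : x - ∑ i, ω i x • v i ∈ T := by
  simp [h.mem_iff, h.dual]

theorem hom_ext [Finite ι] (h : TransverseFrame T ω v) {M : Type*} [AddCommGroup M] [Module K M]
    {α β : E →ₗ[K] M} (hT : ∀ t ∈ T, α t = β t) (hv : ∀ i, α (v i) = β (v i)) : α = β := by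
  have := Fintype.ofFinite ι
  ext x
  simpa [hv] using hT _ (h.sub_sum_mem x)

theorem eq_sum_smul [Fintype ι] (h : TransverseFrame T ω v) {α : Module.Dual K E}
    (hα : ∀ t ∈ T, α t = 0) : α = ∑ i, α (v i) • ω i :=
  h.hom_ext (fun t ht => by simp [hα t ht, h.mem_iff.1 ht]) fun j => by simp [h.dual]

theorem exists_glue [Finite ι] [Nontrivial ι] (h : TransverseFrame T ω v)
    {η : ι → Module.Dual K E} (hT : ∀ t ∈ T, ∀ i l, η i t = η l t)
    (hv : ∀ i l j, i ≠ j → l ≠ j → η i (v j) = η l (v j)) :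
    ∃ θ : Module.Dual K E, ∀ i, ∃ a : K, θ = η i + a • ω i := by
  have := Fintype.ofFinite ι
  obtain ⟨i₀⟩ : Nonempty ι := inferInstance
  choose σ hσ using fun j : ι => exists_ne j
  let θ := η i₀ + ∑ j, (η (σ j) (v j) - η i₀ (v j)) • ω j
  have θ_frame : ∀ j, θ (v j) = η (σ j) (v j) := fun j => by simp [θ, h.dual]
  refine ⟨θ, fun i => ⟨(θ - η i) (v i), ?_⟩⟩
  have kills : ∀ t ∈ T, (θ - η i) t = 0 := fun t ht => by
    simp [θ, h.mem_iff.1 ht, hT t ht i₀ i]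
  rw [← sub_eq_iff_eq_add', h.eq_sum_smul kills, Finset.sum_eq_single i _ (by simp)]
  · simp [h.dual]
  · intro j _ hj
    rw [LinearMap.sub_apply, θ_frame, hv (σ j) i j (hσ j) hj.symm, sub_self, zero_smul]

end CommRing

section Field

variable {K E ι : Type*} [Field K] [AddCommGroup E] [Module K E] [DecidableEq ι]
  {T : Submodule K E} {ω : ι → Module.Dual K E} {v : ι → E}

theorem rescale (h : TransverseFrame T ω v) {c : ι → K} (hc : ∀ i, c i ≠ 0) :
    TransverseFrame T (fun i => c i • ω i) (fun i => (c i)⁻¹ • v i) where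
  iInf_ker := by simp only [LinearMap.ker_smul _ _ (hc _), h.iInf_ker]
  dual i j := by
    rcases eq_or_ne i j with rfl | hij
    · simp [h.dual, hc]
    · simp [h.dual, hij]

end Field

end TransverseFrame

variable {K E : Type*} [Field K] [AddCommGroup E] [Module K E] [FiniteDimensional K E]
  {T : Submodule K E}

theorem exists_transverseFrame {ι : Type*} [Fintype ι] [DecidableEq ι] {ω : ι → Module.Dual K E}
    (hT : ⨅ i, LinearMap.ker (ω i) = T)
    (hcodim : Module.finrank K T + Fintype.card ι = Module.finrank K E) :
    ∃ v, TransverseFrame T ω v := by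
  have rank_nullity := LinearMap.finrank_range_add_finrank_ker (LinearMap.pi ω)
  rw [LinearMap.ker_pi, hT] at rank_nullity
  have surjective : LinearMap.range (LinearMap.pi ω) = ⊤ :=
    Submodule.eq_top_of_finrank_eq (by rw [Module.finrank_fintype_fun_eq_card]; omega)
  choose v hv using fun j => LinearMap.range_eq_top.1 surjective (Pi.single j 1)
  exact ⟨v, hT, fun i j => (congrFun (hv j) i).trans (Pi.single_apply j 1 i)⟩

/-- Rescaling `q` of the functionals makes their sum proportional to the remaining one. -/
theorem exists_transverseFrame_ker_sum {q : ℕ} [NeZero q] {ω : Fin (q + 1) → Module.Dual K E}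
    (hT : ∀ j, ⨅ i ≠ j, LinearMap.ker (ω i) = T)
    (hcodim : Module.finrank K T + q = Module.finrank K E) :
    ∃ (ω' : Fin q → Module.Dual K E) (v : Fin q → E), TransverseFrame T ω' v ∧
      (∀ i, LinearMap.ker (ω' i) = LinearMap.ker (ω i.succ)) ∧
      LinearMap.ker (∑ i, ω' i) = LinearMap.ker (ω 0) := by
  have mem_iff : ∀ j x, x ∈ T ↔ ∀ i ≠ j, ω i x = 0 := fun j x => by simp [← hT j]
  have hT₀ : ⨅ i : Fin q, LinearMap.ker (ω i.succ) = T := by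
    ext x
    simp [mem_iff 0, Fin.forall_fin_succ]
  obtain ⟨v, hv⟩ := exists_transverseFrame hT₀ (by simpa using hcodim)
  have coeff_ne_zero : ∀ i, ω 0 (v i) ≠ 0 := by
    intro i hi
    have : v i ∈ T := (mem_iff i.succ _).2 <| Fin.forall_fin_succ.2
      ⟨fun _ => hi, fun j hj => hv.apply_ne fun h => hj (congrArg _ h)⟩
    simpa [hv.apply_self] using hv.mem_iff.1 this i
  refine ⟨_, _, hv.rescale coeff_ne_zero, fun i => LinearMap.ker_smul _ _ (coeff_ne_zero i), ?_⟩
  rw [← hv.eq_sum_smul fun t ht => (mem_iff (Fin.succ 0) t).1 ht 0 (Fin.succ_ne_zero _).symm]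

end TransverseFrames

section Dichotomy

/-- The derivations which normalize `T`: the infinitesimal symmetries of the foliation `T`. -/
def projectable {k K : Type*} [CommRing k] [CommRing K] [Algebra k K]
    (T : Submodule K (Derivation k K K)) : LieSubalgebra k (Derivation k K K) where
  carrier := {x | ∀ t ∈ T, ⁅t, x⁆ ∈ T}
  add_mem' hx hy t ht := by
    rw [lie_add]
    exact T.add_mem (hx t ht) (hy t ht)
  zero_mem' t _ := by simp
  smul_mem' c x hx t ht := by
    rw [lie_smul, ← algebraMap_smul K c]
    exact T.smul_mem _ (hx t ht)
  lie_mem' {x y} hx hy t ht := by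
    change ⁅t, ⁅x, y⁆⁆ ∈ T
    rw [leibniz_lie, ← lie_skew x ⁅t, y⁆]
    exact T.add_mem (hy _ (hx t ht)) (T.neg_mem (hx _ (hy t ht)))

variable {k K : Type*} [CommRing k] [Field K] [Algebra k K] {T : Submodule K (Derivation k K K)}
  {c c' : Derivation k K K → K} {x y : Derivation k K K}

variable (T c) in
/-- Modulo `T`, each `t ∈ T` acts on `x` by the scalar `c t`. -/
def IsWeightVector (x : Derivation k K K) : Prop :=
  ∀ t ∈ T, ⁅t, x⁆ - c t • x ∈ T

variable (T c) in
/-- Each `t ∈ T` acts on `f` by the scalar `c t`. -/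
def IsSemiInvariant (f : K) : Prop :=
  ∀ t ∈ T, t f = c t * f

open OneForm

theorem IsWeightVector.inv_smul_mem_projectable (hx : IsWeightVector T c x) {f : K} (hf : f ≠ 0)
    (hfc : IsSemiInvariant T c f) : f⁻¹ • x ∈ projectable T := by
  intro t ht
  have : ⁅t, f⁻¹ • x⁆ = f⁻¹ • (⁅t, x⁆ - c t • x) := by
    rw [LieRinehartRing.leibniz_smul_right, Derivation.bracket_eq_fun, Derivation.leibniz_inv,
      hfc t ht, smul_sub, sub_eq_add_neg, smul_smul, ← neg_smul]
    congr 2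
    rw [smul_eq_mul]
    field_simp
  rw [this]
  exact T.smul_mem _ (hx t ht)

theorem IsWeightVector.apply_lie (hx : IsWeightVector T c x) {t : Derivation k K K} (ht : t ∈ T)
    {M : Type*} [AddCommGroup M] [Module K M] {α : Derivation k K K →ₗ[K] M}
    (hα : ∀ t ∈ T, α t = 0) : α ⁅t, x⁆ = c t • α x := by
  simpa [sub_eq_zero] using hα _ (hx t ht)

theorem IsWeightVector.isSemiInvariant_apply (hx : IsWeightVector T c x) {β : OneForm k K}
    (hβ : ∀ t ∈ T, β t = 0) (hd : ∀ t ∈ T, extD β t x = 0) : IsSemiInvariant T c (β x) := by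
  intro t ht
  have := hd t ht
  rw [extD_apply, hβ t ht, hx.apply_lie ht hβ, map_zero, sub_zero, sub_eq_zero] at this
  exact this

theorem IsWeightVector.isSemiInvariant_extD (hx : IsWeightVector T c x)
    (hy : IsWeightVector T c' y) {θ : OneForm k K} (hθ : ∀ t ∈ T, extD θ t = 0) :
    IsSemiInvariant T (c + c') (extD θ x y) := by
  intro t ht
  have closed := extD_extD θ t x y
  rw [hx.apply_lie ht hθ, ← lie_skew y t, map_neg, hy.apply_lie ht hθ, extD_swap θ y t,
    extD_swap θ _ t, hθ t ht] at closed
  simp only [LinearMap.zero_apply, LinearMap.smul_apply, LinearMap.neg_apply, map_zero, neg_zero,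
    smul_eq_mul, extD_swap θ y x] at closed
  rw [Pi.add_apply]
  linear_combination closed

namespace TransverseFrame

variable {ι : Type*} [DecidableEq ι] {ω : ι → OneForm k K}
  {v : ι → Derivation k K K}

theorem exists_isWeightVector [Fintype ι] (h : TransverseFrame T ω v)
    (hω : ∀ i, IsInvolutive (LinearMap.ker (ω i)))
    (hsum : IsInvolutive (LinearMap.ker (∑ i, ω i))) :
    ∃ c : Derivation k K K → K, ∀ i, IsWeightVector T c (v i) := by
  rcases isEmpty_or_nonempty ι with _ | ⟨⟨i₀⟩⟩
  · exact ⟨0, isEmptyElim⟩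
  have off_diagonal : ∀ t ∈ T, ∀ i j, i ≠ j → ω i ⁅t, v j⁆ = 0 := fun t ht i j hij =>
    hω i t (h.mem_iff.1 ht i) _ (h.apply_ne hij)
  have sum_lie : ∀ t ∈ T, ∀ j, (∑ i, ω i) ⁅t, v j⁆ = ω j ⁅t, v j⁆ := fun t ht j => by
    rw [LinearMap.sum_apply]
    exact Finset.sum_eq_single j (fun i _ hij => off_diagonal t ht i j hij) (by simp)
  have diagonal : ∀ t ∈ T, ∀ i j, ω i ⁅t, v i⁆ = ω j ⁅t, v j⁆ := fun t ht i j => by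
    have := hsum t (by simp [h.mem_iff.1 ht]) (v i - v j) (by simp [h.dual])
    rwa [lie_sub, LinearMap.mem_ker, map_sub, sum_lie t ht, sum_lie t ht, sub_eq_zero] at this
  refine ⟨fun t => ω i₀ ⁅t, v i₀⁆, fun j t ht => h.mem_iff.2 fun i => ?_⟩
  rcases eq_or_ne i j with rfl | hij
  · simp [h.dual, diagonal t ht i i₀]
  · simp [h.dual, hij, off_diagonal t ht i j hij]

theorem wedge_coeff_apply (h : TransverseFrame T ω v) {i : ι} (hc : IsWeightVector T c (v i))
    {η : OneForm k K} (hη : extD (ω i) = wedge η (ω i)) {t : Derivation k K K} (ht : t ∈ T) :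
    η t = -c t := by
  have kills : ∀ t ∈ T, ω i t = 0 := fun t ht => h.mem_iff.1 ht i
  have := congr($hη t (v i))
  rw [extD_apply, wedge_apply, hc.apply_lie ht kills, kills t ht, h.apply_self] at this
  simpa using this.symm

theorem exists_common_wedge [Finite ι] [Nontrivial ι] (h : TransverseFrame T ω v)
    (hc : ∀ i, IsWeightVector T c (v i)) (hT : ∀ f, IsSemiInvariant T c f → f = 0)
    (hω : ∀ i, IsInvolutive (LinearMap.ker (ω i))) :
    ∃ θ, ∀ i, extD (ω i) = wedge θ (ω i) := by
  choose η hη using fun i => exists_extD_eq_wedge (h.apply_self i) (hω i)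
  have η_apply : ∀ t ∈ T, ∀ i l, η i t = η l t := fun t ht i l => by
    rw [h.wedge_coeff_apply (hc i) (hη i) ht, h.wedge_coeff_apply (hc l) (hη l) ht]
  have extD_η : ∀ i j, i ≠ j → ∀ t ∈ T, extD (η i) t (v j) = 0 := fun i j hij t ht => by
    simpa [h.apply_self, h.apply_ne hij, h.mem_iff.1 ht i] using
      OneForm.extD_wedge (hη i) t (v j) (v i)
  obtain ⟨θ, hθ⟩ := h.exists_glue η_apply fun i l j hij hlj => sub_eq_zero.1 <|
    hT ((η i - η l) (v j)) <| (hc j).isSemiInvariant_apply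
      (fun t ht => by simp [η_apply t ht i l])
      fun t ht => by simp [extD_η i j hij t ht, extD_η l j hlj t ht]
  refine ⟨θ, fun i => ?_⟩
  obtain ⟨a, ha⟩ := hθ i
  rw [ha, wedge_add_smul_self, hη i]

theorem extD_common_wedge_eq_zero [Nontrivial ι] (h : TransverseFrame T ω v) {θ : OneForm k K}
    (hθ : ∀ i, extD (ω i) = wedge θ (ω i)) {t : Derivation k K K} (ht : t ∈ T) :
    extD θ t = 0 := by
  have proportional : ∀ i a, extD θ t a = extD θ t (v i) * ω i a := fun i a => by
    have := OneForm.extD_wedge (hθ i) t a (v i)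
    rw [h.apply_self, h.mem_iff.1 ht, extD_swap θ (v i) t] at this
    linear_combination this
  obtain ⟨i, j, hij⟩ := exists_pair_ne ι
  have vanish : extD θ t (v i) = 0 := by rw [proportional j, h.apply_ne hij.symm, mul_zero]
  ext a
  rw [proportional i, vanish, zero_mul, LinearMap.zero_apply]

theorem extD_eq_zero_of_common_wedge [Finite ι] [Nontrivial ι] [NeZero (2 : K)]
    (h : TransverseFrame T ω v) (hc : ∀ i, IsWeightVector T c (v i))
    (hT : ∀ f, IsSemiInvariant T c f → f = 0) {θ : OneForm k K}
    (hθ : ∀ i, extD (ω i) = wedge θ (ω i)) : extD θ = 0 := by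
  have hθT : ∀ t ∈ T, extD θ t = 0 := fun t ht => h.extD_common_wedge_eq_zero hθ ht
  by_contra hne
  obtain ⟨i, j, hij⟩ : ∃ i j, extD θ (v i) (v j) ≠ 0 := by
    by_contra! vanish
    refine hne (h.hom_ext hθT fun i => h.hom_ext (fun t ht => ?_) (vanish i))
    simp [extD_swap θ (v i) t, hθT t ht]
  have weight := (hc i).isSemiInvariant_extD (hc j) hθT
  set f := extD θ (v i) (v j)
  -- `f` has weight `2c` and `θ` restricts to `-c` on `T`, so the following form kills `T`.
  let β : OneForm k K := θ + θ + dlog f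
  have extD_β : extD β = extD θ + extD θ := by simp [β]
  have kills : ∀ t ∈ T, β t = 0 := fun t ht => by
    obtain ⟨l⟩ : Nonempty ι := ⟨i⟩
    simp only [β, LinearMap.add_apply, dlog_apply, weight t ht, Pi.add_apply,
      h.wedge_coeff_apply (hc l) (hθ l) ht]
    field_simp
    ring
  have β_eq_zero : β = 0 := h.hom_ext kills fun l =>
    hT _ ((hc l).isSemiInvariant_apply kills fun t ht => by simp [extD_β, hθT t ht])
  rw [β_eq_zero, map_zero, ← two_smul K] at extD_β
  exact hne ((smul_eq_zero.1 extD_β.symm).resolve_left two_ne_zero)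

theorem exists_closed_wedge_or_projectable [Fintype ι] [Nontrivial ι] [NeZero (2 : K)]
    (h : TransverseFrame T ω v) (hω : ∀ i, IsInvolutive (LinearMap.ker (ω i)))
    (hsum : IsInvolutive (LinearMap.ker (∑ i, ω i))) :
    (∃ θ, extD θ = 0 ∧ ∀ i, extD (ω i) = wedge θ (ω i)) ∨
      ∃ f : K, f ≠ 0 ∧ ∀ i, f⁻¹ • v i ∈ projectable T := by
  obtain ⟨c, hc⟩ := h.exists_isWeightVector hω hsum
  by_cases hT : ∃ f : K, f ≠ 0 ∧ IsSemiInvariant T c f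
  · obtain ⟨f, hf, hfc⟩ := hT
    exact Or.inr ⟨f, hf, fun i => (hc i).inv_smul_mem_projectable hf hfc⟩
  · have hT : ∀ f, IsSemiInvariant T c f → f = 0 := fun f hfc =>
      by_contra fun hf => hT ⟨f, hf, hfc⟩
    obtain ⟨θ, hθ⟩ := h.exists_common_wedge hc hT hω
    exact Or.inl ⟨θ, h.extD_eq_zero_of_common_wedge hc hT hθ, hθ⟩

end TransverseFrame

end Dichotomy

section Descent

universe u

theorem exists_basis_dual_to_coordinates {K : Type*} {ι : Type u} [Field K] [Finite ι]
    (S : Submodule K (ι → K)) :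
    ∃ (κ : Type u) (J : κ → ι) (b : Module.Basis κ K S),
      ∀ (s : S) j, b.repr s j = (s : ι → K) (J j) := by
  classical
  let coord : ι → Module.Dual K S := fun i => LinearMap.proj i ∘ₗ S.subtype
  have span_coord : Submodule.span K (Set.range coord) = ⊤ := by
    rw [← Subspace.dualCoannihilator_dualAnnihilator_eq (W := Submodule.span K (Set.range coord)),
      Submodule.dualAnnihilator_eq_top_iff, eq_bot_iff]
    intro s hs
    ext i
    exact (Submodule.mem_dualCoannihilator s).1 hs _ (Submodule.subset_span ⟨i, rfl⟩)
  obtain ⟨κ, J, -, span_J, independent⟩ := exists_linearIndependent' K coord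
  let B := Module.Basis.mk independent (by rw [span_J, span_coord])
  have := FiniteDimensional.fintypeBasisIndex B
  exact ⟨κ, J, B.dualBasis.map (Module.evalEquiv K S).symm, fun s j => by simp [B, coord]⟩

variable {k K ι : Type*} [CommRing k] [Field K] [Algebra k K] {T : Submodule K (Derivation k K K)}

variable (T) in
/-- The only first integrals of `T` are the constants. -/
def OnlyConstantFirstIntegrals : Prop :=
  ∀ f : K, (∀ t ∈ T, t f = 0) → f ∈ (algebraMap k K).range

variable (k) in
/-- The vectors of `S` with coordinates in `k`. -/
def constantVectors (S : Submodule K (ι → K)) : Submodule k (ι → k) :=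
  (S.restrictScalars k).comap ((Algebra.linearMap k K).compLeft ι)

theorem mem_constantVectors {S : Submodule K (ι → K)} {a : ι → k} :
    a ∈ constantVectors k S ↔ (fun i => algebraMap k K (a i)) ∈ S := Iff.rfl

theorem OnlyConstantFirstIntegrals.span_constantVectors [Finite ι]
    (hT : OnlyConstantFirstIntegrals T) {S : Submodule K (ι → K)}
    (hS : ∀ t ∈ T, ∀ s ∈ S, (fun i => t (s i)) ∈ S) :
    Submodule.span K ((fun a i => algebraMap k K (a i)) '' (constantVectors k S : Set (ι → k)))
      = S := by
  refine le_antisymm (Submodule.span_le.2 (by rintro _ ⟨a, ha, rfl⟩; exact ha)) ?_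
  obtain ⟨κ, J, b, hb⟩ := exists_basis_dual_to_coordinates S
  have b_coord : ∀ i j, (b j : ι → K) (J i) = Finsupp.single j 1 i := fun i j => by
    rw [← hb, b.repr_self]
  have b_constant : ∀ j, ∃ a : ι → k, (fun i => algebraMap k K (a i)) = (b j : ι → K) := by
    intro j
    have derivative_eq_zero : ∀ t (ht : t ∈ T), (⟨_, hS t ht _ (b j).2⟩ : S) = 0 := fun t ht => by
      refine b.ext_elem fun i => ?_
      rw [hb, map_zero, Finsupp.zero_apply]
      change t ((b j : ι → K) (J i)) = 0
      rw [b_coord]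
      rcases eq_or_ne j i with rfl | hji
      · simp
      · simp [hji]
    choose a ha using fun i => hT ((b j : ι → K) i) fun t ht =>
      congrFun (congrArg Subtype.val (derivative_eq_zero t ht)) i
    exact ⟨a, funext ha⟩
  intro s hs
  refine Submodule.map_span_le S.subtype (Set.range b) _ |>.2 ?_ ⟨⟨s, hs⟩, b.mem_span _, rfl⟩
  rintro _ ⟨j, rfl⟩
  obtain ⟨a, ha⟩ := b_constant j
  refine Submodule.subset_span ⟨a, ?_, ha⟩
  rw [SetLike.mem_coe, mem_constantVectors, ha]
  exact (b j).2

end Descent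

section CommonKernels

section LinearAlgebra

variable {k K E ι : Type*} [Field k] [Field K] [Algebra k K] [AddCommGroup E] [Module K E]
  [Fintype ι]

variable (k) in
/-- The pairing of a vector `x` with the `k`-linear combinations `∑ aᵢ ωᵢ`. -/
def constantPairing (ω : ι → Module.Dual K E) : E →ₗ[K] (ι → k) →ₗ[k] K :=
  ((Pi.basisFun k ι).constr K).toLinearMap ∘ₗ LinearMap.pi ω

@[simp]
theorem constantPairing_apply (ω : ι → Module.Dual K E) (x : E) (a : ι → k) :
    constantPairing k ω x a = ∑ i, a i • ω i x := by
  simp [constantPairing, Module.Basis.constr_apply_fintype]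

/-- The common kernel of the functionals `∑ aᵢ ωᵢ` with `a ∈ V`. -/
def commonKernel (ω : ι → Module.Dual K E) (V : Submodule k (ι → k)) : Submodule K E :=
  LinearMap.ker (LinearMap.lcomp K K V.subtype ∘ₗ constantPairing k ω)

theorem mem_commonKernel_iff_le_ker {ω : ι → Module.Dual K E} {V : Submodule k (ι → k)} {x : E} :
    x ∈ commonKernel ω V ↔ V ≤ LinearMap.ker (constantPairing k ω x) := by
  simp [commonKernel, LinearMap.ext_iff, SetLike.le_def]

theorem mem_commonKernel {ω : ι → Module.Dual K E} {V : Submodule k (ι → k)} {x : E} :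
    x ∈ commonKernel ω V ↔ ∀ a ∈ V, ∑ i, a i • ω i x = 0 := by
  simp [mem_commonKernel_iff_le_ker, SetLike.le_def]

theorem commonKernel_span (ω : ι → Module.Dual K E) (s : Set (ι → k)) :
    commonKernel ω (Submodule.span k s) = ⨅ a ∈ s, LinearMap.ker (∑ i, a i • ω i) := by
  ext x
  simp [mem_commonKernel_iff_le_ker, Submodule.span_le, Set.subset_def]

variable {T : Submodule K E} {ω : ι → Module.Dual K E} {v : ι → E}

theorem TransverseFrame.sum_smul_injective [DecidableEq ι] (h : TransverseFrame T ω v) :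
    Function.Injective fun a : ι → k => ∑ i, a i • ω i := by
  intro a b hab
  ext j
  simpa [h.dual, Algebra.smul_def] using congr($hab (v j))

theorem TransverseFrame.constantPairing_surjective [DecidableEq ι] (h : TransverseFrame T ω v) :
    Function.Surjective (constantPairing k ω) := by
  refine ((Pi.basisFun k ι).constr K).surjective.comp fun c => ⟨∑ j, c j • v j, ?_⟩
  ext i
  simp [h.dual]

theorem TransverseFrame.finrank_commonKernel [DecidableEq ι] [FiniteDimensional K E]
    (h : TransverseFrame T ω v) (V : Submodule k (ι → k)) :
    Module.finrank K (commonKernel ω V) + Module.finrank k V = Module.finrank K E := by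
  have restrict_surjective : Function.Surjective (LinearMap.lcomp K K V.subtype) := fun f =>
    LinearMap.exists_extend f
  have surjective : Function.Surjective
      (LinearMap.lcomp K K V.subtype ∘ₗ constantPairing k ω) := by
    rw [LinearMap.coe_comp]
    exact restrict_surjective.comp h.constantPairing_surjective
  have rank_nullity := LinearMap.finrank_range_add_finrank_ker
    (LinearMap.lcomp K K V.subtype ∘ₗ constantPairing k ω)
  rw [LinearMap.range_eq_top.2 surjective, finrank_top,
    Module.finrank_linearMap_self] at rank_nullity
  rwa [add_comm]

theorem TransverseFrame.commonKernel_injective [DecidableEq ι] (h : TransverseFrame T ω v) :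
    Function.Injective (commonKernel ω : Submodule k (ι → k) → Submodule K E) := by
  have reconstruct : ∀ {V V' : Submodule k (ι → k)}, commonKernel ω V ≤ commonKernel ω V' →
      V' ≤ V := by
    intro V V' hV a ha
    by_contra ha'
    obtain ⟨f, hf, hfV⟩ := Submodule.exists_le_ker_of_notMem ha'
    obtain ⟨x, hx⟩ := h.constantPairing_surjective (Algebra.linearMap k K ∘ₗ f)
    have hxV : x ∈ commonKernel ω V := mem_commonKernel_iff_le_ker.2 <| by
      rw [hx]
      exact hfV.trans (LinearMap.ker_le_ker_comp f _)
    have := mem_commonKernel_iff_le_ker.1 (hV hxV) ha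
    simp [hx, hf] at this
  exact fun V V' hV => le_antisymm (reconstruct hV.ge) (reconstruct hV.le)

end LinearAlgebra

variable {k K ι : Type*} [Field k] [Field K] [Algebra k K] [Fintype ι]
  {T : Submodule K (Derivation k K K)} {η : OneForm k K} {ω : ι → OneForm k K}
  {v : ι → Derivation k K K}

open OneForm

theorem extD_sum_smul_eq_wedge (hω : ∀ i, extD (ω i) = wedge η (ω i)) (a : ι → k) :
    extD (∑ i, a i • ω i) = wedge η (∑ i, a i • ω i) := by
  ext x y
  simp [hω, Finset.mul_sum, Finset.sum_mul, smul_sub]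

theorem isInvolutive_commonKernel (hω : ∀ i, extD (ω i) = wedge η (ω i))
    (V : Submodule k (ι → k)) : IsInvolutive (commonKernel ω V) := by
  rw [← V.span_eq, commonKernel_span]
  exact .iInf fun a => .iInf fun _ =>
    isInvolutive_ker_of_extD_eq_wedge (extD_sum_smul_eq_wedge hω a)

/-- The coefficients of the combinations of the `ω i` which vanish on `W`. -/
def annihilatingCoefficients (ω : ι → OneForm k K) (W : Submodule K (Derivation k K K)) :
    Submodule K (ι → K) :=
  W.dualAnnihilator.comap (Fintype.linearCombination K ω)

theorem mem_annihilatingCoefficients {W : Submodule K (Derivation k K K)} {s : ι → K} :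
    s ∈ annihilatingCoefficients ω W ↔ ∀ x ∈ W, ∑ i, s i * ω i x = 0 := by
  simp [annihilatingCoefficients, Submodule.mem_dualAnnihilator, Fintype.linearCombination_apply]

theorem TransverseFrame.derivation_mem_annihilatingCoefficients [DecidableEq ι]
    (h : TransverseFrame T ω v) (hω : ∀ i, extD (ω i) = wedge η (ω i))
    {W : Submodule K (Derivation k K K)} (hTW : T ≤ W) (hW : IsInvolutive W)
    {t : Derivation k K K} (ht : t ∈ T) {s : ι → K}
    (hs : s ∈ annihilatingCoefficients ω W) :
    (fun i => t (s i)) ∈ annihilatingCoefficients ω W := by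
  rw [mem_annihilatingCoefficients] at hs ⊢
  intro x hx
  have lie_derivative : ∀ i, t (ω i x) = ω i ⁅t, x⁆ + η t * ω i x := fun i => by
    have := congr($(hω i) t x)
    rw [extD_apply, wedge_apply, h.mem_iff.1 ht, map_zero, zero_mul, sub_zero, sub_zero] at this
    linear_combination this
  calc ∑ i, t (s i) * ω i x
      = t (∑ i, s i * ω i x) - ∑ i, s i * ω i ⁅t, x⁆ - η t * ∑ i, s i * ω i x := by
        simp only [map_sum, Derivation.leibniz, lie_derivative, smul_eq_mul, Finset.mul_sum,
          ← Finset.sum_sub_distrib]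
        exact Finset.sum_congr rfl fun i _ => by ring
    _ = 0 := by rw [hs x hx, hs _ (hW _ (hTW ht) _ hx), map_zero, mul_zero, sub_zero, sub_zero]

theorem TransverseFrame.commonKernel_constantVectors [DecidableEq ι] (h : TransverseFrame T ω v)
    (hconst : OnlyConstantFirstIntegrals T) (hω : ∀ i, extD (ω i) = wedge η (ω i))
    {W : Submodule K (Derivation k K K)} (hTW : T ≤ W) (hW : IsInvolutive W) :
    commonKernel ω (constantVectors k (annihilatingCoefficients ω W)) = W := by
  apply le_antisymm
  · intro x hx
    rw [← Subspace.dualAnnihilator_dualCoannihilator_eq (W := W), Submodule.mem_dualCoannihilator]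
    have kills_x : annihilatingCoefficients ω W ≤
        LinearMap.ker (Fintype.linearCombination K fun i => ω i x) := by
      rw [← hconst.span_constantVectors fun t ht s hs =>
        h.derivation_mem_annihilatingCoefficients hω hTW hW ht hs, Submodule.span_le]
      rintro _ ⟨a, ha, rfl⟩
      simpa [Algebra.smul_def, Fintype.linearCombination_apply] using mem_commonKernel.1 hx a ha
    intro α hα
    have α_eq := h.eq_sum_smul fun t ht => (Submodule.mem_dualAnnihilator α).1 hα t (hTW ht)
    have : (fun i => α (v i)) ∈ annihilatingCoefficients ω W := by
      rwa [annihilatingCoefficients, Submodule.mem_comap, Fintype.linearCombination_apply, ← α_eq]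
    rw [α_eq]
    simpa [Fintype.linearCombination_apply] using kills_x this
  · intro x hx
    refine mem_commonKernel.2 fun a ha => ?_
    simpa [Algebra.smul_def] using mem_annihilatingCoefficients.1 (mem_constantVectors.1 ha) x hx

theorem TransverseFrame.range_commonKernel [DecidableEq ι] (h : TransverseFrame T ω v)
    (hconst : OnlyConstantFirstIntegrals T) (hω : ∀ i, extD (ω i) = wedge η (ω i)) :
    Set.range (commonKernel ω : Submodule k (ι → k) → _) = {W | T ≤ W ∧ IsInvolutive W} := by
  ext W
  constructor
  · rintro ⟨V, rfl⟩
    refine ⟨fun x hx => mem_commonKernel.2 fun a _ => ?_, isInvolutive_commonKernel hω V⟩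
    simp [h.mem_iff.1 hx]
  · exact fun ⟨hTW, hW⟩ => ⟨_, h.commonKernel_constantVectors hconst hω hTW hW⟩

end CommonKernels

section LieValuedForms

variable {k K 𝔤 : Type*} [CommRing k] [CommRing K] [Algebra k K] [LieRing 𝔤] [LieAlgebra k 𝔤]

theorem rTensor_derivation_smul (E : Type*) [AddCommGroup E] [Module k E] (d : Derivation k K K)
    (f : K) (y : K ⊗[k] E) :
    LinearMap.rTensor E (d : K →ₗ[k] K) (f • y) =
      d f • y + f • LinearMap.rTensor E (d : K →ₗ[k] K) y := by
  induction y with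
  | zero => simp
  | add a b ha hb =>
    simp only [smul_add, map_add, ha, hb]
    abel
  | tmul g e =>
    simp only [TensorProduct.smul_tmul', smul_eq_mul, LinearMap.rTensor_tmul,
      ← TensorProduct.add_tmul, Derivation.coeFn_coe, Derivation.leibniz, mul_comm g, add_comm]

theorem rTensor_smul_derivation (E : Type*) [AddCommGroup E] [Module k E] (d : Derivation k K K)
    (f : K) (y : K ⊗[k] E) :
    LinearMap.rTensor E ((f • d : Derivation k K K) : K →ₗ[k] K) y =
      f • LinearMap.rTensor E (d : K →ₗ[k] K) y := by
  induction y with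
  | zero => simp
  | add a b ha hb => simp only [map_add, ha, hb, smul_add]
  | tmul g e => simp [TensorProduct.smul_tmul']

theorem rTensor_add_derivation (E : Type*) [AddCommGroup E] [Module k E]
    (d d' : Derivation k K K) (y : K ⊗[k] E) :
    LinearMap.rTensor E ((d + d' : Derivation k K K) : K →ₗ[k] K) y =
      LinearMap.rTensor E (d : K →ₗ[k] K) y + LinearMap.rTensor E (d' : K →ₗ[k] K) y := by
  rw [Derivation.coe_add_linearMap, LinearMap.rTensor_add, LinearMap.add_apply]

/-- The curvature `dΩ + ½[Ω, Ω]` of a form with values in `𝔤`, as a bilinear map on derivations;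
it vanishes when `Ω` satisfies the Maurer-Cartan equation. -/
def curvature (Ω : Derivation k K K →ₗ[K] K ⊗[k] 𝔤) :
    Derivation k K K →ₗ[K] Derivation k K K →ₗ[K] K ⊗[k] 𝔤 :=
  LinearMap.mk₂ K
    (fun v w => LinearMap.rTensor 𝔤 (v : K →ₗ[k] K) (Ω w)
      - LinearMap.rTensor 𝔤 (w : K →ₗ[k] K) (Ω v) - Ω ⁅v, w⁆ + ⁅Ω v, Ω w⁆)
    (fun v v' w => by
      simp only [rTensor_add_derivation, map_add, add_lie]
      abel)
    (fun f v w => by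
      simp only [rTensor_smul_derivation, rTensor_derivation_smul, map_smul, map_sub, smul_lie,
        smul_lie_derivation, smul_add, smul_sub]
      abel)
    (fun v w w' => by
      simp only [rTensor_add_derivation, map_add, lie_add]
      abel)
    (fun f v w => by
      simp only [rTensor_smul_derivation, rTensor_derivation_smul, map_smul, map_add, lie_smul,
        LieRinehartRing.leibniz_smul_right, Derivation.bracket_eq_fun, smul_add, smul_sub]
      abel)

theorem curvature_apply (Ω : Derivation k K K →ₗ[K] K ⊗[k] 𝔤) (v w : Derivation k K K) :
    curvature Ω v w = LinearMap.rTensor 𝔤 (v : K →ₗ[k] K) (Ω w)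
      - LinearMap.rTensor 𝔤 (w : K →ₗ[k] K) (Ω v) - Ω ⁅v, w⁆ + ⁅Ω v, Ω w⁆ := rfl

/-- The kernel of the composition of `Ω` with the projection to `𝔤 / 𝔥`. -/
def kernelModulo (Ω : Derivation k K K →ₗ[K] K ⊗[k] 𝔤) (𝔥 : LieSubalgebra k 𝔤) :
    Submodule K (Derivation k K K) :=
  LinearMap.ker (𝔥.toSubmodule.mkQ.baseChange K ∘ₗ Ω)

theorem mem_kernelModulo {Ω : Derivation k K K →ₗ[K] K ⊗[k] 𝔤} {𝔥 : LieSubalgebra k 𝔤}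
    {v : Derivation k K K} :
    v ∈ kernelModulo Ω 𝔥 ↔ LinearMap.lTensor K 𝔥.toSubmodule.mkQ (Ω v) = 0 := Iff.rfl

theorem lTensor_mkQ_lie_eq_zero {𝔥 : LieSubalgebra k 𝔤} {a b : K ⊗[k] 𝔤}
    (ha : LinearMap.lTensor K 𝔥.toSubmodule.mkQ a = 0)
    (hb : LinearMap.lTensor K 𝔥.toSubmodule.mkQ b = 0) :
    LinearMap.lTensor K 𝔥.toSubmodule.mkQ ⁅a, b⁆ = 0 := by
  simp only [← LinearMap.mem_ker, lTensor_mkQ] at ha hb ⊢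
  obtain ⟨a, rfl⟩ := ha
  obtain ⟨b, rfl⟩ := hb
  induction a with
  | zero => simp
  | add a a' iha iha' => simpa only [map_add, add_lie] using add_mem iha iha'
  | tmul f x =>
    induction b with
    | zero => simp
    | add b b' ihb ihb' => simpa only [map_add, lie_add] using add_mem ihb ihb'
    | tmul g y => exact ⟨(f * g) ⊗ₜ[k] ⟨⁅(x : 𝔤), (y : 𝔤)⁆, 𝔥.lie_mem x.2 y.2⟩, rfl⟩

theorem isInvolutive_kernelModulo {Ω : Derivation k K K →ₗ[K] K ⊗[k] 𝔤} (hΩ : curvature Ω = 0)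
    (𝔥 : LieSubalgebra k 𝔤) : IsInvolutive (kernelModulo Ω 𝔥) := by
  intro v hv w hw
  rw [mem_kernelModulo] at hv hw ⊢
  have commute : ∀ (d : Derivation k K K) (y : K ⊗[k] 𝔤),
      LinearMap.lTensor K 𝔥.toSubmodule.mkQ (LinearMap.rTensor 𝔤 (d : K →ₗ[k] K) y) =
        LinearMap.rTensor _ (d : K →ₗ[k] K) (LinearMap.lTensor K 𝔥.toSubmodule.mkQ y) :=
    fun d y => by
      rw [← LinearMap.comp_apply, ← LinearMap.comp_apply, LinearMap.lTensor_comp_rTensor,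
        LinearMap.rTensor_comp_lTensor]
  have structure_equation := congr(LinearMap.lTensor K 𝔥.toSubmodule.mkQ ($hΩ v w))
  simpa [curvature_apply, commute, hv, hw, lTensor_mkQ_lie_eq_zero hv hw]
    using structure_equation

end LieValuedForms

section KernelModuloRank

variable {k K 𝔤 : Type*} [Field k] [Field K] [Algebra k K] [LieRing 𝔤] [LieAlgebra k 𝔤]

theorem finrank_kernelModulo_add_eq_iff [FiniteDimensional K (Derivation k K K)] [Module.Finite k 𝔤]
    {Ω : Derivation k K K →ₗ[K] K ⊗[k] 𝔤} (hΩ : Function.Surjective Ω) (𝔥 : LieSubalgebra k 𝔤)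
    {r : ℕ} : Module.finrank K (kernelModulo Ω 𝔥) + r = Module.finrank K (Derivation k K K) ↔
      Module.finrank k 𝔥 + r = Module.finrank k 𝔤 := by
  have surjective : Function.Surjective (𝔥.toSubmodule.mkQ.baseChange K ∘ₗ Ω) := by
    rw [LinearMap.coe_comp]
    exact (LinearMap.lTensor_surjective K 𝔥.toSubmodule.mkQ_surjective).comp hΩ
  have rank_nullity := LinearMap.finrank_range_add_finrank_ker
    (𝔥.toSubmodule.mkQ.baseChange K ∘ₗ Ω)
  rw [LinearMap.range_eq_top.2 surjective, finrank_top, Module.finrank_baseChange] at rank_nullity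
  have quotient : Module.finrank k (𝔤 ⧸ 𝔥.toSubmodule) + Module.finrank k 𝔥 = Module.finrank k 𝔤 :=
    𝔥.toSubmodule.finrank_quotient_add_finrank
  rw [kernelModulo]
  omega

end KernelModuloRank

section TransverseSymmetries

variable {k K : Type*} [CommRing k] [CommRing K] [Algebra k K]

/-- `T` as an ideal of the Lie algebra of its infinitesimal symmetries. -/
def tangentIdeal (T : Submodule K (Derivation k K K)) : LieIdeal k (projectable T) where
  __ := (T.restrictScalars k).comap (projectable T).toSubmodule.subtype
  lie_mem {x m} hm := by
    change ⁅(x : Derivation k K K), (m : Derivation k K K)⁆ ∈ T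
    rw [← lie_skew]
    exact T.neg_mem (x.2 _ hm)

/-- The Lie algebra of transverse symmetries of `T`. -/
abbrev TransverseAlgebra (T : Submodule K (Derivation k K K)) : Type _ :=
  projectable T ⧸ tangentIdeal T

/-- The transverse symmetry induced by an infinitesimal symmetry of `T`. -/
def transverseClass (T : Submodule K (Derivation k K K)) :
    projectable T →ₗ⁅k⁆ TransverseAlgebra T where
  __ := (LieSubmodule.Quotient.mk' (tangentIdeal T) : projectable T →ₗ[k] TransverseAlgebra T)
  map_lie' {x y} := LieSubmodule.Quotient.mk_bracket _ x y

theorem transverseClass_surjective (T : Submodule K (Derivation k K K)) :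
    Function.Surjective (transverseClass T) := LieSubmodule.Quotient.surjective_mk' _

theorem transverseClass_eq_zero {T : Submodule K (Derivation k K K)} {x : projectable T} :
    transverseClass T x = 0 ↔ (x : Derivation k K K) ∈ T :=
  LieSubmodule.Quotient.mk_eq_zero _

/-- The comparison map from transverse symmetries, with coefficients extended to `K`, to the
normal space of `T`. -/
def transverseComparison (T : Submodule K (Derivation k K K)) :
    K ⊗[k] TransverseAlgebra T →ₗ[K] Derivation k K K ⧸ T :=
  LinearMap.liftBaseChange K <| Submodule.liftQ (tangentIdeal T).toSubmodule
    (T.mkQ.restrictScalars k ∘ₗ (projectable T).toSubmodule.subtype)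
    fun _ hx => (Submodule.Quotient.mk_eq_zero T).2 hx

@[simp]
theorem transverseComparison_tmul {T : Submodule K (Derivation k K K)} (f : K)
    (x : projectable T) :
    transverseComparison T (f ⊗ₜ transverseClass T x) = f • T.mkQ (x : Derivation k K K) := rfl

end TransverseSymmetries

section TransverselyLie

variable {k K : Type*} [Field k] [Field K] [Algebra k K]

/-- `T` is an involutive distribution without non-constant first integrals, whose normal space is
generated by transverse symmetries. -/
structure IsTransverselyLie (T : Submodule K (Derivation k K K)) : Prop where
  isInvolutive : IsInvolutive T
  constants : OnlyConstantFirstIntegrals T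
  span_projectable : Submodule.span K (projectable T : Set (Derivation k K K)) = ⊤

variable {T W : Submodule K (Derivation k K K)}

theorem derivation_mem_comap_linearCombination {ι : Type*} [Fintype ι] {x : ι → projectable T}
    (hTW : T ≤ W) (hW : IsInvolutive W) {t : Derivation k K K} (ht : t ∈ T) {s : ι → K}
    (hs : s ∈ W.comap (Fintype.linearCombination K fun i => (x i : Derivation k K K))) :
    (fun i => t (s i)) ∈
      W.comap (Fintype.linearCombination K fun i => (x i : Derivation k K K)) := by
  simp only [Submodule.mem_comap, Fintype.linearCombination_apply] at hs ⊢
  have brackets : ∑ i, s i • ⁅t, (x i : Derivation k K K)⁆ ∈ W :=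
    W.sum_mem fun i _ => W.smul_mem _ (hTW ((x i).2 t ht))
  have := W.sub_mem (hW t (hTW ht) _ hs) brackets
  simpa [lie_sum, LieRinehartRing.leibniz_smul_right, Finset.sum_add_distrib] using this

namespace IsTransverselyLie

theorem span_projectable_inter (hT : IsTransverselyLie T) (hTW : T ≤ W) (hW : IsInvolutive W) :
    Submodule.span K ((projectable T : Set (Derivation k K K)) ∩ W) = W := by
  refine le_antisymm (Submodule.span_le.2 Set.inter_subset_right) fun w hw => ?_
  obtain ⟨n, s, x, rfl⟩ := Submodule.mem_span_set'.1 (hT.span_projectable ▸ Submodule.mem_top :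
    w ∈ Submodule.span K (projectable T : Set (Derivation k K K)))
  suffices W.comap (Fintype.linearCombination K fun i => (x i : Derivation k K K)) ≤
      Submodule.comap (Fintype.linearCombination K fun i => (x i : Derivation k K K))
        (Submodule.span K ((projectable T : Set (Derivation k K K)) ∩ W)) from this hw
  rw [← hT.constants.span_constantVectors fun t ht s hs =>
    derivation_mem_comap_linearCombination hTW hW ht hs, Submodule.span_le]
  rintro _ ⟨a, ha, rfl⟩
  refine Submodule.subset_span ⟨?_, ha⟩
  simp only [Fintype.linearCombination_apply, algebraMap_smul]
  exact sum_mem fun i _ => (projectable T).smul_mem (a i) (x i).2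

theorem linearIndependent_mkQ (hT : IsTransverselyLie T) {ι : Type*} {x : ι → projectable T}
    (hx : LinearIndependent k fun i => transverseClass T (x i)) :
    LinearIndependent K fun i => T.mkQ (x i : Derivation k K K) := by
  rw [linearIndependent_iff_finset_linearIndependent] at hx ⊢
  intro I
  have no_relation : T.comap (Fintype.linearCombination K
      fun i : I => (x i : Derivation k K K)) = ⊥ := by
    rw [← hT.constants.span_constantVectors fun t ht s hs =>
      derivation_mem_comap_linearCombination le_rfl hT.isInvolutive ht hs, Submodule.span_eq_bot]
    rintro _ ⟨a, ha, rfl⟩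
    have relation : ∑ i : I, a i • transverseClass T (x i) = 0 := by
      simp only [← map_smul, ← map_sum, transverseClass_eq_zero]
      simpa [mem_constantVectors, Fintype.linearCombination_apply] using ha
    have a_eq_zero := Fintype.linearIndependent_iff.1 (hx I) a relation
    ext i
    simp [a_eq_zero]
  rw [Fintype.linearIndependent_iff]
  intro f hf
  refine congrFun ((Submodule.mem_bot K).1 (no_relation ▸ ?_ : f ∈ (⊥ : Submodule K (I → K))))
  simp only [Function.comp_apply, ← map_smul, ← map_sum] at hf
  exact (Submodule.Quotient.mk_eq_zero T).1 hf

theorem transverseComparison_injective (hT : IsTransverselyLie T) :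
    Function.Injective (transverseComparison T) := by
  let b := Module.Free.chooseBasis k (TransverseAlgebra T)
  choose x hx using fun i => transverseClass_surjective T (b i)
  have comparison_basis : transverseComparison T ∘ b.baseChange K =
      fun i => T.mkQ (x i : Derivation k K K) := by
    ext i
    simp [← hx]
  refine LinearMap.injective_of_linearIndependent (b.baseChange K).span_eq ?_
  rw [comparison_basis]
  exact hT.linearIndependent_mkQ (by simpa only [hx] using b.linearIndependent)

theorem transverseComparison_surjective (hT : IsTransverselyLie T) :
    Function.Surjective (transverseComparison T) := by
  rw [← LinearMap.range_eq_top, eq_top_iff, ← T.range_mkQ, LinearMap.range_eq_map,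
    ← hT.span_projectable, Submodule.map_span_le]
  exact fun x hx => ⟨1 ⊗ₜ transverseClass T ⟨x, hx⟩, by simp⟩

/-- The linear isomorphism between the normal space of `T` and the transverse symmetries with
coefficients extended to `K`. -/
def comparisonEquiv (hT : IsTransverselyLie T) :
    (K ⊗[k] TransverseAlgebra T) ≃ₗ[K] Derivation k K K ⧸ T :=
  LinearEquiv.ofBijective (transverseComparison T)
    ⟨hT.transverseComparison_injective, hT.transverseComparison_surjective⟩

/-- The canonical form with values in the transverse symmetries, which sends each infinitesimal
symmetry of `T` to the transverse symmetry it induces. -/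
def form (hT : IsTransverselyLie T) : Derivation k K K →ₗ[K] K ⊗[k] TransverseAlgebra T :=
  hT.comparisonEquiv.symm.toLinearMap ∘ₗ T.mkQ

theorem form_apply (hT : IsTransverselyLie T) (x : projectable T) :
    hT.form (x : Derivation k K K) = 1 ⊗ₜ transverseClass T x :=
  hT.comparisonEquiv.symm_apply_eq.2 <|
    ((transverseComparison_tmul 1 x).trans (one_smul _ _)).symm

theorem ker_form (hT : IsTransverselyLie T) : LinearMap.ker hT.form = T := by
  rw [form, LinearEquiv.ker_comp, T.ker_mkQ]

theorem form_surjective (hT : IsTransverselyLie T) : Function.Surjective hT.form := by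
  rw [form, LinearMap.coe_comp]
  exact hT.comparisonEquiv.symm.surjective.comp T.mkQ_surjective

theorem curvature_form (hT : IsTransverselyLie T) : curvature hT.form = 0 := by
  refine LinearMap.ext_on hT.span_projectable fun x hx =>
    LinearMap.ext_on hT.span_projectable fun y hy => ?_
  have form_x := hT.form_apply ⟨x, hx⟩
  have form_y := hT.form_apply ⟨y, hy⟩
  have form_lie := hT.form_apply ⁅(⟨x, hx⟩ : projectable T), ⟨y, hy⟩⁆
  rw [LieHom.map_lie] at form_lie
  simp only [LieSubalgebra.coe_bracket] at form_x form_y form_lie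
  simp [curvature_apply, form_x, form_y, form_lie]

theorem mem_kernelModulo_form (hT : IsTransverselyLie T) {𝔥 : LieSubalgebra k (TransverseAlgebra T)}
    (x : projectable T) :
    (x : Derivation k K K) ∈ kernelModulo hT.form 𝔥 ↔ transverseClass T x ∈ 𝔥 := by
  have one_tmul_injective := Module.FaithfullyFlat.tensorProduct_mk_injective (A := k) (B := K)
    (TransverseAlgebra T ⧸ 𝔥.toSubmodule)
  rw [mem_kernelModulo, hT.form_apply, LinearMap.lTensor_tmul, ← TensorProduct.mk_apply,
    map_eq_zero_iff _ one_tmul_injective]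
  exact Submodule.Quotient.mk_eq_zero _

theorem kernelModulo_form_injective (hT : IsTransverselyLie T) :
    Function.Injective (kernelModulo hT.form) := by
  intro 𝔥 𝔥' h𝔥
  ext y
  obtain ⟨x, rfl⟩ := transverseClass_surjective T y
  rw [← hT.mem_kernelModulo_form, h𝔥, hT.mem_kernelModulo_form]

theorem le_kernelModulo_form (hT : IsTransverselyLie T)
    (𝔥 : LieSubalgebra k (TransverseAlgebra T)) : T ≤ kernelModulo hT.form 𝔥 := by
  conv_lhs => rw [← hT.ker_form]
  exact LinearMap.ker_le_ker_comp _ _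

/-- The transverse symmetries induced by the infinitesimal symmetries in `W`. -/
def subalgebraOf (hW : IsInvolutive W) : LieSubalgebra k (TransverseAlgebra T) where
  __ := ((W.restrictScalars k).comap (projectable T).toSubmodule.subtype).map
    (transverseClass T : projectable T →ₗ[k] TransverseAlgebra T)
  lie_mem' := by
    rintro _ _ ⟨x, hx, rfl⟩ ⟨y, hy, rfl⟩
    exact ⟨⁅x, y⁆, hW _ hx _ hy, LieHom.map_lie _ _ _⟩

theorem transverseClass_mem_subalgebraOf (hTW : T ≤ W) (hW : IsInvolutive W) {x : projectable T} :
    transverseClass T x ∈ subalgebraOf (T := T) hW ↔ (x : Derivation k K K) ∈ W := by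
  refine ⟨?_, fun hx => ⟨x, hx, rfl⟩⟩
  rintro ⟨y, hy, hyx⟩
  have : ((x - y : projectable T) : Derivation k K K) ∈ T := by
    rw [← transverseClass_eq_zero, map_sub, sub_eq_zero]
    exact hyx.symm
  exact (W.sub_mem_iff_left hy).1 (hTW this)

theorem range_kernelModulo_form (hT : IsTransverselyLie T) :
    Set.range (kernelModulo hT.form) = {W | T ≤ W ∧ IsInvolutive W} := by
  ext W
  constructor
  · rintro ⟨𝔥, rfl⟩
    exact ⟨hT.le_kernelModulo_form 𝔥, isInvolutive_kernelModulo hT.curvature_form 𝔥⟩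
  · rintro ⟨hTW, hW⟩
    refine ⟨subalgebraOf hW, ?_⟩
    have same_projectable : (projectable T : Set (Derivation k K K)) ∩
        kernelModulo hT.form (subalgebraOf hW) = (projectable T : Set _) ∩ W :=
      Set.ext fun x => and_congr_right fun hx =>
        (hT.mem_kernelModulo_form ⟨x, hx⟩).trans (transverseClass_mem_subalgebraOf hTW hW)
    refine .trans ?_ (hT.span_projectable_inter hTW hW)
    rw [← same_projectable, hT.span_projectable_inter (hT.le_kernelModulo_form _)
      (isInvolutive_kernelModulo hT.curvature_form _)]

variable [FiniteDimensional K (Derivation k K K)]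

theorem finite_transverseAlgebra (hT : IsTransverselyLie T) :
    Module.Finite k (TransverseAlgebra T) := by
  have := Module.Finite.equiv hT.comparisonEquiv.symm
  rw [← Module.rank_lt_aleph0_iff] at this ⊢
  rwa [Module.rank_baseChange, Cardinal.lift_lt_aleph0] at this

theorem finrank_transverseAlgebra (hT : IsTransverselyLie T) :
    Module.finrank K T + Module.finrank k (TransverseAlgebra T) =
      Module.finrank K (Derivation k K K) := by
  rw [add_comm, ← Module.finrank_baseChange (R := K), hT.comparisonEquiv.finrank_eq,
    T.finrank_quotient_add_finrank]

end IsTransverselyLie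

end TransverselyLie

section TransverseStructure

open OneForm

variable {k K ι : Type*} [Field k] [Field K] [Algebra k K] [DecidableEq ι]
  {T : Submodule K (Derivation k K K)} {ω : ι → OneForm k K} {v : ι → Derivation k K K}

namespace TransverseFrame

theorem isTransverselyLie [Finite ι] (h : TransverseFrame T ω v) (hT : IsInvolutive T)
    (hconst : OnlyConstantFirstIntegrals T) (hv : ∀ i, v i ∈ projectable T) :
    IsTransverselyLie T where
  isInvolutive := hT
  constants := hconst
  span_projectable := by
    have := Fintype.ofFinite ι
    rw [eq_top_iff]
    intro x _
    rw [← sub_add_cancel x (∑ i, ω i x • v i)]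
    refine add_mem (Submodule.subset_span fun t ht => hT t ht _ (h.sub_sum_mem x)) ?_
    exact sum_mem fun i _ => Submodule.smul_mem _ _ (Submodule.subset_span (hv i))

theorem extD_eq_zero_of_isLieAbelian [Finite ι] (h : TransverseFrame T ω v) (hT : IsInvolutive T)
    (hv : ∀ i, v i ∈ projectable T) [IsLieAbelian (TransverseAlgebra T)] (i : ι) :
    extD (ω i) = 0 := by
  have vanishes_of_lie_mem : ∀ a b, ω i a ∈ (algebraMap k K).range →
      ω i b ∈ (algebraMap k K).range → ⁅a, b⁆ ∈ T → extD (ω i) a b = 0 := by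
    rintro a b ⟨c, hc⟩ ⟨d, hd⟩ hab
    simp [extD_apply, ← hc, ← hd, h.mem_iff.1 hab i]
  have const_T : ∀ t ∈ T, ω i t ∈ (algebraMap k K).range := fun t ht => by
    simp only [h.mem_iff.1 ht i, zero_mem]
  have const_v : ∀ j, ω i (v j) ∈ (algebraMap k K).range := fun j => by
    rw [h.dual]
    split_ifs
    exacts [one_mem _, zero_mem _]
  have lie_frame : ∀ j l, ⁅v j, v l⁆ ∈ T := fun j l => by
    rw [← LieSubalgebra.coe_bracket _ ⟨v j, hv j⟩ ⟨v l, hv l⟩, ← transverseClass_eq_zero,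
      LieHom.map_lie, trivial_lie_zero]
  have extD_tangent : ∀ t ∈ T, extD (ω i) t = 0 := fun t ht => h.hom_ext
    (fun t' ht' => vanishes_of_lie_mem _ _ (const_T t ht) (const_T t' ht') (hT t ht t' ht'))
    fun j => vanishes_of_lie_mem _ _ (const_T t ht) (const_v j) (hv j t ht)
  refine h.hom_ext extD_tangent fun j => h.hom_ext (fun t ht => ?_) fun l =>
    vanishes_of_lie_mem _ _ (const_v j) (const_v l) (lie_frame j l)
  simp [extD_swap _ (v j) t, extD_tangent t ht]

theorem exists_closed_wedge_or_isTransverselyLie [Fintype ι] [Nontrivial ι] [NeZero (2 : K)]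
    (h : TransverseFrame T ω v) (hω : ∀ i, IsInvolutive (LinearMap.ker (ω i)))
    (hsum : IsInvolutive (LinearMap.ker (∑ i, ω i))) (hconst : OnlyConstantFirstIntegrals T) :
    (∃ (ω' : ι → OneForm k K) (v' : ι → Derivation k K K) (η : OneForm k K),
      TransverseFrame T ω' v' ∧ extD η = 0 ∧ ∀ i, extD (ω' i) = wedge η (ω' i)) ∨
    (IsTransverselyLie T ∧ ¬ IsLieAbelian (TransverseAlgebra T)) := by
  obtain ⟨η, hη, hωη⟩ | ⟨f, hf, hv⟩ := h.exists_closed_wedge_or_projectable hω hsum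
  · exact .inl ⟨ω, v, η, h, hη, hωη⟩
  have frame := h.rescale (c := fun _ => f) fun _ => hf
  have hT : IsInvolutive T := h.iInf_ker ▸ .iInf hω
  by_cases abelian : IsLieAbelian (TransverseAlgebra T)
  · refine .inl ⟨_, _, 0, frame, map_zero _, fun i => ?_⟩
    rw [frame.extD_eq_zero_of_isLieAbelian hT hv]
    ext
    simp
  · exact .inr ⟨frame.isTransverselyLie hT hconst hv, abelian⟩

end TransverseFrame

end TransverseStructure

section DerivationsAndSubrings

variable {k A K : Type*} [CommRing k] [CommRing A] [Algebra k A] [Field K] [Algebra k K]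

theorem derivation_map_mem_of_adjoin_eq_top {φ : A →ₐ[k] K} {R : Subring K} (hφ : ∀ a, φ a ∈ R)
    {s : Set A} (hs : Algebra.adjoin k s = ⊤) {v : Derivation k K K} (hv : ∀ a ∈ s, v (φ a) ∈ R)
    (a : A) : v (φ a) ∈ R := by
  have ha : a ∈ Algebra.adjoin k s := hs ▸ Algebra.mem_top
  induction ha using Algebra.adjoin_induction with
  | mem a ha => exact hv a ha
  | algebraMap c => simp
  | add a b _ _ ha hb => simpa only [map_add] using R.add_mem ha hb
  | mul a b _ _ ha hb =>
    simpa only [map_mul, Derivation.leibniz, smul_eq_mul] using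
      R.add_mem (R.mul_mem (hφ a) hb) (R.mul_mem (hφ b) ha)

theorem derivation_div_mem {R : Subring K} {v : Derivation k K K} {a b : K} (ha : a ∈ R)
    (hb : b ∈ R) (hb' : b⁻¹ ∈ R) (hva : v a ∈ R) (hvb : v b ∈ R) : v (a / b) ∈ R := by
  rw [Derivation.leibniz_div]
  exact R.mul_mem (R.pow_mem hb' 2) (R.sub_mem (R.mul_mem hb hva) (R.mul_mem ha hvb))

theorem exists_eq_div_of_mem_range_of_isLocalization {L : Type*} [CommRing L] [Algebra A L]
    (M : Submonoid A) [IsLocalization M L] (σ : L →+* K) {f : K} (hf : f ∈ σ.range) :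
    ∃ a b : A, (σ (algebraMap A L b))⁻¹ ∈ σ.range ∧
      f = σ (algebraMap A L a) / σ (algebraMap A L b) := by
  obtain ⟨s, rfl⟩ := hf
  obtain ⟨a, b, rfl⟩ := IsLocalization.exists_mk'_eq M s
  have hunit : σ (IsLocalization.mk' L 1 b) * σ (algebraMap A L b) = 1 := by
    rw [← map_mul, IsLocalization.mk'_spec, map_one, map_one]
  refine ⟨a, b, ⟨_, eq_inv_of_mul_eq_one_left hunit⟩, ?_⟩
  rw [eq_div_iff (right_ne_zero_of_mul_eq_one hunit), ← map_mul, IsLocalization.mk'_spec]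

end DerivationsAndSubrings

namespace ProjectiveManifold

section LocalRings

variable {X : ProjectiveManifold}

theorem genericPoint_mem (U : X.NonemptyOpen) : genericPoint X.scheme ∈ U.1 :=
  ((genericPoint_spec X.scheme).mem_open_set_iff U.1.isOpen).2 (by simpa using U.2)

instance : Nonempty X.NonemptyOpen := ⟨⟨⊤, genericPoint X.scheme, trivial⟩⟩

instance : IsCodirectedOrder X.NonemptyOpen where
  directed U V :=
    ⟨⟨U.1 ⊓ V.1, genericPoint X.scheme, genericPoint_mem U, genericPoint_mem V⟩,
      inf_le_left (a := U.1), inf_le_right (a := U.1)⟩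

instance (U : X.NonemptyOpen) : Nonempty U.1 := U.2.to_subtype

theorem mem_functions {U : X.NonemptyOpen} {f : X.RationalFunction} :
    f ∈ X.functions U ↔ ∀ x ∈ U.1, f ∈ X.localRing x := by
  simp only [functions, Subring.mem_iInf]

theorem exists_mem_functions (f : X.RationalFunction) :
    ∃ U : X.NonemptyOpen, f ∈ X.functions U := by
  obtain ⟨U, hU, g, hg⟩ := X.scheme.presheaf.exists_germ_eq (x := genericPoint X.scheme) f
  refine ⟨⟨U, ⟨_, hU⟩⟩, mem_functions.2 fun x hx => ⟨X.scheme.presheaf.germ U x hx g, ?_⟩⟩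
  have : Nonempty U := ⟨⟨x, hx⟩⟩
  exact (Scheme.algebraMap_germ_eq_germToFunctionField X.scheme hx g).trans hg

theorem functions_anti : Antitone X.functions := fun _ _ h _ hf =>
  mem_functions.2 fun x hx => mem_functions.1 hf x (h hx)

theorem exists_forall_mem_functions (s : Finset X.RationalFunction) :
    ∃ U : X.NonemptyOpen, ∀ f ∈ s, f ∈ X.functions U := by
  choose U hU using exists_mem_functions (X := X)
  classical
  obtain ⟨V, hV⟩ := functions_anti.directed_le.finset_le (s.image U)
  exact ⟨V, fun f hf => hV _ (Finset.mem_image_of_mem U hf) (hU f)⟩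

end LocalRings

section Sections

variable {X : ProjectiveManifold}

/-- The inclusion of the constants in `𝒪_X(U)`. -/
def constantSections (U : X.NonemptyOpen) : ℂ →+* Γ(X.scheme, U.1) :=
  (X.structureMap.appLE ⊤ U.1 le_top).hom.comp (Scheme.ΓSpecIso (CommRingCat.of ℂ)).inv.hom

instance (U : X.NonemptyOpen) : Algebra ℂ Γ(X.scheme, U.1) := (constantSections U).toAlgebra

/-- The rational function given by a section of `𝒪_X` on a non-empty open set. -/
def sectionToRationalFunction (U : X.NonemptyOpen) :
    Γ(X.scheme, U.1) →ₐ[ℂ] X.RationalFunction where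
  toRingHom := (X.scheme.germToFunctionField U.1).hom
  commutes' c := by
    change (X.scheme.presheaf.germ U.1 _ _).hom ((X.structureMap.appLE ⊤ U.1 le_top).hom _) =
      (X.scheme.presheaf.germ ⊤ (genericPoint X.scheme) trivial).hom
        ((X.structureMap.appTop).hom _)
    rw [← X.scheme.presheaf.germ_res (homOfLE (le_top : U.1 ≤ ⊤)) _ (genericPoint_mem U)]
    rfl

theorem algebraMap_germ_eq_sectionToRationalFunction {U : X.NonemptyOpen} {x : X.scheme}
    (hx : x ∈ U.1) (g : Γ(X.scheme, U.1)) :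
    algebraMap (X.scheme.presheaf.stalk x) X.scheme.functionField
      (X.scheme.presheaf.germ U.1 x hx g) = sectionToRationalFunction U g :=
  Scheme.algebraMap_germ_eq_germToFunctionField X.scheme hx g

theorem sectionToRationalFunction_mem_localRing {U : X.NonemptyOpen} {x : X.scheme}
    (hx : x ∈ U.1) (g : Γ(X.scheme, U.1)) : sectionToRationalFunction U g ∈ X.localRing x :=
  ⟨_, algebraMap_germ_eq_sectionToRationalFunction hx g⟩

variable (X) in
theorem exists_isAffineOpen : ∃ U : X.NonemptyOpen, IsAffineOpen U.1 := by
  obtain ⟨U, hU, hxU, -⟩ := exists_isAffineOpen_mem_and_subset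
    (x := genericPoint X.scheme) (U := ⊤) trivial
  exact ⟨⟨U, _, hxU⟩, hU⟩

theorem finiteType_sections {U : X.NonemptyOpen} (hU : IsAffineOpen U.1) :
    Algebra.FiniteType ℂ Γ(X.scheme, U.1) := by
  have := X.smooth
  refine RingHom.FiniteType.comp (Scheme.Hom.finiteType_appLE _ (isAffineOpen_top _) hU _)
    (RingHom.FiniteType.of_surjective _ ?_)
  exact (ConcreteCategory.bijective_of_isIso (Scheme.ΓSpecIso (CommRingCat.of ℂ)).inv).2

theorem exists_eq_div_of_mem_localRing {U : X.NonemptyOpen} (hU : IsAffineOpen U.1)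
    {x : X.scheme} (hx : x ∈ U.1) {f : X.RationalFunction} (hf : f ∈ X.localRing x) :
    ∃ a b, (sectionToRationalFunction U b)⁻¹ ∈ X.localRing x ∧
      f = sectionToRationalFunction U a / sectionToRationalFunction U b := by
  let _ := X.scheme.presheaf.algebra_section_stalk ⟨x, hx⟩
  have := hU.isLocalization_stalk ⟨x, hx⟩
  obtain ⟨a, b, hb, hab⟩ := exists_eq_div_of_mem_range_of_isLocalization
    (hU.primeIdealOf ⟨x, hx⟩).asIdeal.primeCompl
    (algebraMap (X.scheme.presheaf.stalk x) X.scheme.functionField) hf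
  refine ⟨a, b, ?_, hab.trans ?_⟩
  · rw [← algebraMap_germ_eq_sectionToRationalFunction hx]
    exact hb
  · rw [← algebraMap_germ_eq_sectionToRationalFunction hx,
      ← algebraMap_germ_eq_sectionToRationalFunction hx]
    rfl

variable (X) in
instance : Algebra.EssFiniteType ℂ X.RationalFunction := by
  obtain ⟨U, hU⟩ := X.exists_isAffineOpen
  have := finiteType_sections hU
  let _ : Algebra Γ(X.scheme, U.1) X.RationalFunction :=
    (sectionToRationalFunction U).toRingHom.toAlgebra
  have : IsScalarTower ℂ Γ(X.scheme, U.1) X.RationalFunction :=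
    .of_algebraMap_eq fun c => ((sectionToRationalFunction U).commutes c).symm
  have : IsFractionRing Γ(X.scheme, U.1) X.RationalFunction :=
    functionField_isFractionRing_of_isAffineOpen X.scheme U.1 hU
  have : Algebra.EssFiniteType Γ(X.scheme, U.1) X.RationalFunction :=
    .of_isLocalization _ (nonZeroDivisors Γ(X.scheme, U.1))
  exact .comp ℂ Γ(X.scheme, U.1) X.RationalFunction

end Sections

section VectorFieldsAndForms

variable {X : ProjectiveManifold}

theorem vectorFields_anti : Antitone X.vectorFields := fun _ _ h _ hv x hx => hv x (h hx)

theorem forms_anti : Antitone X.forms := fun _ _ h _ hω x hx => hω x (h hx)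

theorem exists_mem_vectorFields (v : X.RationalVectorField) :
    ∃ U : X.NonemptyOpen, v ∈ X.vectorFields U := by
  classical
  obtain ⟨U, hU⟩ := X.exists_isAffineOpen
  obtain ⟨s, hs⟩ := (finiteType_sections hU).out
  obtain ⟨V, hV⟩ := exists_forall_mem_functions (s.image fun a => v (sectionToRationalFunction U a))
  obtain ⟨W, hWU, hWV⟩ := exists_le_le U V
  refine ⟨W, fun x hx f hf => ?_⟩
  have hmem := sectionToRationalFunction_mem_localRing (hWU hx)
  have hvmem := derivation_map_mem_of_adjoin_eq_top hmem hs fun a ha =>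
    mem_functions.1 (hV _ (Finset.mem_image_of_mem _ ha)) x (hWV hx)
  obtain ⟨a, b, hb, rfl⟩ := exists_eq_div_of_mem_localRing hU (hWU hx) hf
  exact derivation_div_mem (hmem a) (hmem b) hb (hvmem a) (hvmem b)

theorem smul_mem_forms {U : X.NonemptyOpen} {f : X.RationalFunction} (hf : f ∈ X.functions U)
    {ω : X.RationalForm} (hω : ω ∈ X.forms U) : f • ω ∈ X.forms U := fun x hx =>
  Submodule.smul_mem _ (⟨f, mem_functions.1 hf x hx⟩ : X.localRing x) (hω x hx)

theorem exists_mem_forms (ω : X.RationalForm) : ∃ U : X.NonemptyOpen, ω ∈ X.forms U := by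
  have hω : ω ∈ Submodule.span X.RationalFunction
      (Set.range (KaehlerDifferential.D ℂ X.RationalFunction)) := by
    simp only [KaehlerDifferential.span_range_derivation, Submodule.mem_top]
  induction hω using Submodule.span_induction with
  | mem ω h =>
    obtain ⟨f, rfl⟩ := h
    obtain ⟨U, hU⟩ := exists_mem_functions f
    exact ⟨U, fun x hx => Submodule.subset_span ⟨f, mem_functions.1 hU x hx, rfl⟩⟩
  | zero => exact ⟨Classical.arbitrary _, fun x _ => Submodule.zero_mem _⟩
  | add a b _ _ ha hb =>
    obtain ⟨U, hU⟩ := ha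
    obtain ⟨V, hV⟩ := hb
    obtain ⟨W, hWU, hWV⟩ := exists_le_le U V
    exact ⟨W, fun x hx => Submodule.add_mem _ (hU x (hWU hx)) (hV x (hWV hx))⟩
  | smul f ω _ hω =>
    obtain ⟨U, hU⟩ := exists_mem_functions f
    obtain ⟨V, hV⟩ := hω
    obtain ⟨W, hWU, hWV⟩ := exists_le_le U V
    exact ⟨W, smul_mem_forms (functions_anti hWU hU) (forms_anti hWV hV)⟩

theorem smul_mem_vectorFields {U : X.NonemptyOpen} {f : X.RationalFunction}
    (hf : f ∈ X.functions U) {v : X.RationalVectorField} (hv : v ∈ X.vectorFields U) :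
    f • v ∈ X.vectorFields U := fun x hx g hg =>
  Subring.mul_mem _ (mem_functions.1 hf x hx) (hv x hx g hg)

theorem lie_mem_vectorFields {U : X.NonemptyOpen} {v w : X.RationalVectorField}
    (hv : v ∈ X.vectorFields U) (hw : w ∈ X.vectorFields U) : ⁅v, w⁆ ∈ X.vectorFields U := by
  intro x hx f hf
  rw [Derivation.commutator_apply]
  exact Subring.sub_mem _ (hv x hx _ (hw x hx f hf)) (hw x hx _ (hv x hx f hf))

variable (X) in
instance : FiniteDimensional X.RationalFunction X.RationalVectorField :=
  Module.Finite.equiv (KaehlerDifferential.linearMapEquivDerivation ℂ X.RationalFunction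
    (M := X.RationalFunction))

variable (X) in
instance : CharZero X.RationalFunction :=
  charZero_of_injective_algebraMap (algebraMap ℂ _).injective

variable (X) in
/-- The identification `ω ↦ (v ↦ ω(v))` of rational `1`-forms with linear functionals on rational
vector fields. -/
def formEquiv : X.RationalForm ≃ₗ[X.RationalFunction] OneForm ℂ X.RationalFunction :=
  (Module.evalEquiv X.RationalFunction X.RationalForm).trans
    (KaehlerDifferential.linearMapEquivDerivation ℂ X.RationalFunction
      (M := X.RationalFunction)).symm.dualMap

theorem formEquiv_apply (ω : X.RationalForm) (v : X.RationalVectorField) :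
    X.formEquiv ω v = X.contract ω v := rfl

theorem contract_formEquiv_symm (φ : OneForm ℂ X.RationalFunction) (v : X.RationalVectorField) :
    X.contract (X.formEquiv.symm φ) v = φ v := by
  rw [← formEquiv_apply, LinearEquiv.apply_symm_apply]

theorem extDeriv_formEquiv_symm (φ : OneForm ℂ X.RationalFunction) (v w : X.RationalVectorField) :
    X.extDeriv (X.formEquiv.symm φ) v w = OneForm.extD φ v w := by
  simp only [extDeriv, OneForm.extD_apply, contract_formEquiv_symm]

end VectorFieldsAndForms

end ProjectiveManifold

namespace Foliation

variable {X : ProjectiveManifold}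

open ProjectiveManifold

section TangentSpaces

variable {F G : Foliation X}

theorem conormal_anti (F : Foliation X) :
    Antitone fun U => (F.conormal U : Set X.RationalForm) := by
  intro V U h ω hω
  rw [SetLike.mem_coe, F.mem_conormal_iff] at hω ⊢
  exact ⟨forms_anti h hω.1, fun V' hV' v hv => hω.2 V' (hV'.trans h) v hv⟩

/-- The space of rational sections of the tangent sheaf of `F`, defined as the annihilator of the
rational conormal sections. -/
def tangentSpace (F : Foliation X) : Submodule X.RationalFunction X.RationalVectorField :=
  (F.rationalConormal.map X.formEquiv.toLinearMap).dualCoannihilator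

theorem mem_tangentSpace {v : X.RationalVectorField} :
    v ∈ F.tangentSpace ↔ ∀ U, ∀ ω ∈ F.conormal U, X.contract ω v = 0 := by
  rw [tangentSpace, rationalConormal, Submodule.map_span, ← SetLike.mem_coe,
    Submodule.coe_dualCoannihilator_span]
  refine Set.forall_mem_image.trans ?_
  simp only [Set.mem_iUnion, SetLike.mem_coe]
  exact ⟨fun h U ω hω => h ⟨U, hω⟩, fun h ω ⟨U, hω⟩ => h U ω hω⟩

theorem finrank_tangentSpace_add_codim (F : Foliation X) :
    Module.finrank X.RationalFunction F.tangentSpace + F.codim =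
      Module.finrank X.RationalFunction X.RationalVectorField := by
  rw [codim, ← LinearEquiv.finrank_map_eq X.formEquiv, add_comm]
  exact Subspace.finrank_add_finrank_dualCoannihilator_eq _

theorem mem_tangent {U : X.NonemptyOpen} {v : X.RationalVectorField} :
    v ∈ F.tangent U ↔ v ∈ X.vectorFields U ∧ v ∈ F.tangentSpace := by
  rw [F.mem_tangent_iff, mem_tangentSpace]
  refine and_congr_right fun _ => ⟨fun h U' ω hω => ?_, fun h V _ ω hω => h V ω hω⟩
  obtain ⟨V, hVU, hVU'⟩ := exists_le_le U U'
  exact h V hVU ω (F.conormal_anti hVU' hω)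

theorem exists_mem_tangent {v : X.RationalVectorField} (hv : v ∈ F.tangentSpace) :
    ∃ U, v ∈ F.tangent U := by
  obtain ⟨U, hU⟩ := exists_mem_vectorFields v
  exact ⟨U, mem_tangent.2 ⟨hU, hv⟩⟩

theorem tangentSpace_injective : Function.Injective (tangentSpace (X := X)) := by
  intro F F' h
  have tangent_eq : F.tangent = F'.tangent := by
    ext U v
    rw [mem_tangent, mem_tangent, h]
  refine Foliation.ext tangent_eq ?_
  ext U ω
  rw [F.mem_conormal_iff, F'.mem_conormal_iff, tangent_eq]

theorem isInvolutive_tangentSpace (F : Foliation X) : IsInvolutive F.tangentSpace := by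
  intro v hv w hw
  obtain ⟨U, hU⟩ := exists_mem_vectorFields v
  obtain ⟨V, hV⟩ := exists_mem_vectorFields w
  obtain ⟨W, hWU, hWV⟩ := exists_le_le U V
  exact (mem_tangent.1 (F.involutive W v (mem_tangent.2 ⟨vectorFields_anti hWU hU, hv⟩)
    w (mem_tangent.2 ⟨vectorFields_anti hWV hV, hw⟩))).2

theorem containedIn_iff : G.ContainedIn F ↔ G.tangentSpace ≤ F.tangentSpace := by
  refine ⟨fun h v hv => ?_, fun h U v hv => ?_⟩
  · obtain ⟨U, hU⟩ := exists_mem_tangent hv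
    exact (mem_tangent.1 (h U v hU)).2
  · exact mem_tangent.2 ((mem_tangent.1 hv).imp_right fun hv => h hv)

theorem definedBy_iff {S : Set X.RationalVectorField} :
    F.DefinedBy S ↔ (F.tangentSpace : Set X.RationalVectorField) = S := by
  refine ⟨fun h => Set.ext fun v => ?_, fun h U v => by rw [mem_tangent, ← h, SetLike.mem_coe]⟩
  obtain ⟨U, hU⟩ := exists_mem_vectorFields v
  simpa [mem_tangent, hU] using h U v

theorem isIntersection_iff {S : Set (Foliation X)} :
    F.IsIntersection S ↔ F.tangentSpace = ⨅ H ∈ S, H.tangentSpace := by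
  have definedBy_inter : F.IsIntersection S ↔ F.DefinedBy {v | ∀ H ∈ S, v ∈ H.tangentSpace} :=
    forall₂_congr fun U v => iff_congr Iff.rfl <| and_congr_right fun hv =>
      forall₂_congr fun H _ => mem_tangent.trans (and_iff_right hv)
  rw [definedBy_inter, definedBy_iff, Set.ext_iff, SetLike.ext_iff]
  simp only [SetLike.mem_coe, Set.mem_ofPred_eq, Submodule.mem_iInf]

theorem onlyConstantFirstIntegrals_of_trdeg_eq_zero (hF : Algebra.trdeg ℂ F.firstIntegrals = 0) :
    OnlyConstantFirstIntegrals F.tangentSpace := by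
  intro f hf
  have := trdeg_eq_zero_iff.1 hF
  obtain ⟨c, hc⟩ := (IsAlgClosed.algebraMap_bijective_of_isIntegral (k := ℂ)
    (K := F.firstIntegrals)).2 ⟨f, fun U v hv => hf v (mem_tangent.1 hv).2⟩
  exact ⟨c, congrArg Subtype.val hc⟩

theorem exists_ker_eq_tangentSpace_of_codim_eq_one (hF : F.codim = 1) :
    ∃ α : OneForm ℂ X.RationalFunction, LinearMap.ker α = F.tangentSpace := by
  have finrank_normal : Module.finrank X.RationalFunction
      (X.RationalVectorField ⧸ F.tangentSpace) =
      Module.finrank X.RationalFunction X.RationalFunction := by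
    rw [Module.finrank_self]
    have := F.finrank_tangentSpace_add_codim
    have := Submodule.finrank_quotient_add_finrank F.tangentSpace
    omega
  refine ⟨(LinearEquiv.ofFinrankEq _ _ finrank_normal).toLinearMap ∘ₗ F.tangentSpace.mkQ, ?_⟩
  rw [LinearEquiv.ker_comp, Submodule.ker_mkQ]

end TangentSpaces

section FoliationsFromDistributions

variable (W : Submodule X.RationalFunction X.RationalVectorField)

/-- The `𝒪_X(U)`-module of the vector fields in `W` which are regular on `U`. -/
def regularSections (U : X.NonemptyOpen) : Submodule (X.functions U) X.RationalVectorField where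
  carrier := {v | v ∈ X.vectorFields U ∧ v ∈ W}
  add_mem' hv hw :=
    ⟨fun x hx f hf => Subring.add_mem _ (hv.1 x hx f hf) (hw.1 x hx f hf), W.add_mem hv.2 hw.2⟩
  zero_mem' := ⟨fun _ _ _ _ => Subring.zero_mem _, W.zero_mem⟩
  smul_mem' f _ hv := ⟨smul_mem_vectorFields f.2 hv.1, W.smul_mem f.1 hv.2⟩

/-- The `𝒪_X(U)`-module of the `1`-forms vanishing on `W` which are regular on `U`. -/
def regularAnnihilator (U : X.NonemptyOpen) : Submodule (X.functions U) X.RationalForm where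
  carrier := {ω | ω ∈ X.forms U ∧ ∀ v ∈ W, X.contract ω v = 0}
  add_mem' ha hb := ⟨fun x hx => Submodule.add_mem _ (ha.1 x hx) (hb.1 x hx), fun v hv => by
    rw [← formEquiv_apply, map_add, LinearMap.add_apply, formEquiv_apply, formEquiv_apply,
      ha.2 v hv, hb.2 v hv, add_zero]⟩
  zero_mem' := ⟨fun _ _ => Submodule.zero_mem _, fun v _ => by simp [← formEquiv_apply]⟩
  smul_mem' f ω hω := ⟨smul_mem_forms f.2 hω.1, fun v hv => by
    change X.contract (f.1 • ω) v = 0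
    rw [← formEquiv_apply, map_smul, LinearMap.smul_apply, formEquiv_apply, hω.2 v hv, smul_zero]⟩

variable {W}

/-- The foliation whose tangent sheaf consists of the vector fields in `W`. -/
def ofSubspace (hW : IsInvolutive W) : Foliation X where
  tangent := regularSections W
  conormal := regularAnnihilator W
  mem_tangent_iff U v := by
    refine and_congr_right fun _ => ⟨fun hv V _ ω hω => hω.2 v hv, fun h => ?_⟩
    by_contra hv
    obtain ⟨α, hαv, hα⟩ := Submodule.exists_le_ker_of_notMem hv
    obtain ⟨U', hU'⟩ := exists_mem_forms (X.formEquiv.symm α)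
    obtain ⟨V, hVU, hVU'⟩ := exists_le_le U U'
    have hω := h V hVU (X.formEquiv.symm α)
      ⟨forms_anti hVU' hU', fun w hw => (contract_formEquiv_symm α w).trans (hα hw)⟩
    exact hαv ((contract_formEquiv_symm α v).symm.trans hω)
  mem_conormal_iff U ω := by
    refine and_congr_right fun _ => ⟨fun h V _ v hv => h v hv.2, fun h v hv => ?_⟩
    obtain ⟨U', hU'⟩ := exists_mem_vectorFields v
    obtain ⟨V, hVU, hVU'⟩ := exists_le_le U U'
    exact h V hVU v ⟨vectorFields_anti hVU' hU', hv⟩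
  involutive _ v hv w hw := ⟨lie_mem_vectorFields hv.1 hw.1, hW v hv.2 w hw.2⟩

theorem tangentSpace_ofSubspace (hW : IsInvolutive W) : (ofSubspace hW).tangentSpace = W :=
  SetLike.coe_injective <| definedBy_iff.1 fun _ _ => Iff.rfl

theorem exists_equiv_foliationsContaining {G : Foliation X} {A : Type*}
    {W : A → Submodule X.RationalFunction X.RationalVectorField} (hW : Function.Injective W)
    (hrange : Set.range W = {U | G.tangentSpace ≤ U ∧ IsInvolutive U}) {r : ℕ} {p : A → Prop}
    (hp : ∀ a, p a ↔ Module.finrank X.RationalFunction (W a) + r =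
      Module.finrank X.RationalFunction X.RationalVectorField) :
    ∃ e : {a // p a} ≃ FoliationsContaining G r, ∀ a, (e a).1.tangentSpace = W a := by
  have distribution : ∀ a, G.tangentSpace ≤ W a ∧ IsInvolutive (W a) := fun a =>
    hrange.subset (Set.mem_range_self a)
  let fol : A → Foliation X := fun a => ofSubspace (distribution a).2
  have tangent_fol : ∀ a, (fol a).tangentSpace = W a := fun a => tangentSpace_ofSubspace _
  have contains_fol : ∀ a, G.ContainedIn (fol a) := fun a =>
    containedIn_iff.2 ((distribution a).1.trans_eq (tangent_fol a).symm)
  have codim_fol : ∀ a, (fol a).codim = r ↔ p a := fun a => by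
    rw [hp, ← (fol a).finrank_tangentSpace_add_codim, tangent_fol, add_right_inj, eq_comm]
  refine ⟨.ofBijective (fun a => ⟨fol a, contains_fol a, (codim_fol a).2 a.2⟩) ⟨fun a b h => ?_,
    fun ⟨H, hGH, hH⟩ => ?_⟩, fun a => tangent_fol a⟩
  · refine Subtype.ext (hW ?_)
    rw [← tangent_fol, ← tangent_fol, Subtype.mk.inj h]
  · obtain ⟨a, ha⟩ := hrange.superset ⟨containedIn_iff.1 hGH, H.isInvolutive_tangentSpace⟩
    obtain rfl : fol a = H := tangentSpace_injective ((tangent_fol a).trans ha)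
    exact ⟨⟨a, (codim_fol a).1 hH⟩, rfl⟩

end FoliationsFromDistributions

section TransverselyAffine

open OneForm

theorem isTransverselyAffine_of_extD_eq_wedge {F : Foliation X} {α η : OneForm ℂ X.RationalFunction}
    (hα : α ≠ 0) (hF : F.tangentSpace = LinearMap.ker α) (hη : extD η = 0)
    (hαη : extD α = wedge η α) : F.IsTransverselyAffine := by
  refine ⟨?_, X.formEquiv.symm α, X.formEquiv.symm (-η), definedBy_iff.2 ?_, fun v w => ?_,
    fun v w => ?_⟩
  · have := F.finrank_tangentSpace_add_codim
    rw [hF, ← Module.Dual.finrank_ker_add_one_of_ne_zero hα] at this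
    exact Nat.add_left_cancel this
  · ext v
    simp [hF, contract_formEquiv_symm]
  · rw [extDeriv_formEquiv_symm, map_neg, hη]
    exact neg_zero
  · rw [extDeriv_formEquiv_symm, hαη]
    simp only [contract_formEquiv_symm, wedge_apply, LinearMap.neg_apply]
    ring

variable {G : Foliation X} {q : ℕ} {ω : Fin q → OneForm ℂ X.RationalFunction}
  {v : Fin q → X.RationalVectorField} {η : OneForm ℂ X.RationalFunction}

theorem identifiedWithGrassmannians (h : TransverseFrame G.tangentSpace ω v)
    (hconst : OnlyConstantFirstIntegrals G.tangentSpace)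
    (hω : ∀ i, extD (ω i) = wedge η (ω i)) : IdentifiedWithGrassmannians G q := by
  refine ⟨fun i => X.formEquiv.symm (ω i), definedBy_iff.2 ?_, fun r _ => ?_⟩
  · ext x
    simp [h.mem_iff, contract_formEquiv_symm]
  obtain ⟨e, he⟩ := exists_equiv_foliationsContaining (h.commonKernel_injective (k := ℂ))
    (h.range_commonKernel hconst hω) (r := r) (p := fun V => Module.finrank ℂ V = r) fun V => by
      rw [← h.finrank_commonKernel V, add_right_inj, eq_comm]
  refine ⟨e, fun V => definedBy_iff.2 ?_⟩
  ext x
  simp [he, mem_commonKernel, contract_formEquiv_symm]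

theorem exists_isIntersection_isTransverselyAffine (h : TransverseFrame G.tangentSpace ω v)
    (hconst : OnlyConstantFirstIntegrals G.tangentSpace) (hη : extD η = 0)
    (hω : ∀ i, extD (ω i) = wedge η (ω i)) {H : Foliation X} (hH : G.ContainedIn H) :
    ∃ S : Set (Foliation X), S.Finite ∧ (∀ A ∈ S, A.IsTransverselyAffine) ∧
      H.IsIntersection S := by
  obtain ⟨V, hV⟩ : ∃ V : Submodule ℂ (Fin q → ℂ), commonKernel ω V = H.tangentSpace :=
    (h.range_commonKernel hconst hω).superset
      ⟨containedIn_iff.1 hH, H.isInvolutive_tangentSpace⟩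
  let b := Module.finBasis ℂ V
  let α : Fin (Module.finrank ℂ V) → OneForm ℂ X.RationalFunction := fun j =>
    ∑ i, (b j : Fin q → ℂ) i • ω i
  have extD_α : ∀ j, extD (α j) = wedge η (α j) := fun j => extD_sum_smul_eq_wedge hω _
  have α_ne_zero : ∀ j, α j ≠ 0 := fun j hj =>
    b.ne_zero j <| Subtype.ext <| h.sum_smul_injective <| hj.trans (by simp)
  let A : Fin (Module.finrank ℂ V) → Foliation X := fun j =>
    ofSubspace (isInvolutive_ker_of_extD_eq_wedge (extD_α j))
  refine ⟨Set.range A, Set.finite_range A, Set.forall_mem_range.2 fun j =>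
    isTransverselyAffine_of_extD_eq_wedge (α_ne_zero j) (tangentSpace_ofSubspace _) hη (extD_α j),
    isIntersection_iff.2 ?_⟩
  have span_b : Submodule.span ℂ (Set.range fun j => (b j : Fin q → ℂ)) = V := by
    rw [show (fun j => (b j : Fin q → ℂ)) = V.subtype ∘ b from rfl, Set.range_comp,
      Submodule.span_image, b.span_eq, Submodule.map_subtype_top]
  have ker_α : commonKernel ω V = ⨅ j, LinearMap.ker (α j) := by
    rw [← congrArg (commonKernel ω) span_b, commonKernel_span, iInf_range]
  rw [← hV, ker_α, iInf_range]
  exact iInf_congr fun j => (tangentSpace_ofSubspace _).symm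

end TransverselyAffine

section TransverselyLie

variable {G : Foliation X} (hG : IsTransverselyLie G.tangentSpace)

include hG

theorem maurerCartan_form : MaurerCartan (X := X) hG.form := fun v w =>
  congr($hG.curvature_form v w)

theorem isTransverseLieStructure_form : IsTransverseLieStructure G hG.form := by
  refine ⟨hG.finite_transverseAlgebra, ?_, definedBy_iff.2 ?_, maurerCartan_form hG⟩
  · exact Nat.add_left_cancel
      (hG.finrank_transverseAlgebra.trans G.finrank_tangentSpace_add_codim.symm)
  · ext x
    simp [← hG.ker_form]

theorem finrank_kernelModulo_form_add_eq_iff {r : ℕ}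
    (𝔥 : LieSubalgebra ℂ (TransverseAlgebra G.tangentSpace)) :
    Module.finrank X.RationalFunction (kernelModulo hG.form 𝔥) + r =
      Module.finrank X.RationalFunction X.RationalVectorField ↔
    Module.finrank ℂ 𝔥 + r = Module.finrank ℂ (TransverseAlgebra G.tangentSpace) :=
  have := hG.finite_transverseAlgebra
  finrank_kernelModulo_add_eq_iff hG.form_surjective 𝔥

theorem identifiedWithSubalgebras (q : ℕ) : IdentifiedWithSubalgebras G q hG.form := by
  intro r _
  obtain ⟨e, he⟩ := exists_equiv_foliationsContaining hG.kernelModulo_form_injective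
    hG.range_kernelModulo_form fun 𝔥 => (finrank_kernelModulo_form_add_eq_iff hG (r := r) 𝔥).symm
  exact ⟨e, fun 𝔥 => definedBy_iff.2 (congrArg SetLike.coe (he 𝔥))⟩

theorem isTransverselyHomogeneous {H : Foliation X} (hH : G.ContainedIn H) :
    H.IsTransverselyHomogeneous := by
  obtain ⟨𝔥, h𝔥⟩ := hG.range_kernelModulo_form.superset
    ⟨containedIn_iff.1 hH, H.isInvolutive_tangentSpace⟩
  exact ⟨TransverseAlgebra G.tangentSpace, inferInstance, inferInstance, hG.form, 𝔥,
    hG.finite_transverseAlgebra, maurerCartan_form hG,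
    (finrank_kernelModulo_form_add_eq_iff hG 𝔥).1
      (h𝔥 ▸ H.finrank_tangentSpace_add_codim),
    definedBy_iff.2 (congrArg SetLike.coe h𝔥.symm)⟩

end TransverselyLie

end Foliation

end

theorem theoremC (X : ProjectiveManifold) (q : ℕ) (hq : 2 ≤ q) (G : Foliation X)
    (hcodim : G.codim = q)
    (htrdeg : Algebra.trdeg ℂ G.firstIntegrals = 0)
    (F : Fin (q + 1) → Foliation X)
    (hF : ∀ i, (F i).codim = 1 ∧ G.ContainedIn (F i))
    (hinter : ∀ j, G.IsIntersection {H | ∃ i, i ≠ j ∧ H = F i}) :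
    (IdentifiedWithGrassmannians G q ∧
      ∀ H : Foliation X, G.ContainedIn H →
        ∃ S : Set (Foliation X), S.Finite ∧ (∀ A ∈ S, A.IsTransverselyAffine) ∧
          H.IsIntersection S) ∨
    (∃ (𝔤 : Type) (_ : LieRing 𝔤) (_ : LieAlgebra ℂ 𝔤) (Ω : LieValuedForm X 𝔤),
      Module.finrank ℂ 𝔤 = q ∧ ¬ IsLieAbelian 𝔤 ∧
      IsTransverseLieStructure G Ω ∧
      IdentifiedWithSubalgebras G q Ω ∧
      ∀ H : Foliation X, G.ContainedIn H → H.IsTransverselyHomogeneous) := by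
  have : Nontrivial (Fin q) := Fin.nontrivial_iff_two_le.2 hq
  have : NeZero q := ⟨by omega⟩
  have hconst := Foliation.onlyConstantFirstIntegrals_of_trdeg_eq_zero htrdeg
  choose φ hφ using fun i => Foliation.exists_ker_eq_tangentSpace_of_codim_eq_one (hF i).1
  have ker_inter : ∀ j, ⨅ i ≠ j, LinearMap.ker (φ i) = G.tangentSpace := fun j => by
    rw [Foliation.isIntersection_iff.1 (hinter j)]
    ext x
    simp only [Submodule.mem_iInf, hφ]
    exact ⟨by rintro h _ ⟨i, hi, rfl⟩; exact h i hi, fun h i hi => h _ ⟨i, hi, rfl⟩⟩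
  have involutive : ∀ i, IsInvolutive (LinearMap.ker (φ i)) := fun i =>
    (hφ i).symm ▸ (F i).isInvolutive_tangentSpace
  obtain ⟨ω, v, frame, ker_ω, ker_sum⟩ := exists_transverseFrame_ker_sum ker_inter
    (hcodim ▸ G.finrank_tangentSpace_add_codim)
  obtain ⟨ω', v', η, frame', hη, hω'⟩ | ⟨hLie, nonabelian⟩ :=
    frame.exists_closed_wedge_or_isTransverselyLie (fun i => ker_ω i ▸ involutive i.succ)
      (ker_sum ▸ involutive 0) hconst
  · exact .inl ⟨Foliation.identifiedWithGrassmannians frame' hconst hω', fun H hH =>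
      Foliation.exists_isIntersection_isTransverselyAffine frame' hconst hη hω' hH⟩
  · have structure_form := Foliation.isTransverseLieStructure_form hLie
    exact .inr ⟨_, _, _, hLie.form, structure_form.2.1.trans hcodim, nonabelian, structure_form,
      Foliation.identifiedWithSubalgebras hLie q,
      fun H hH => Foliation.isTransverselyHomogeneous hLie hH⟩
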